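/- Let $A$ be a complete Noetherian local ring with finite residue field and maximal ideal $\mathfrak m_A$, equipped with its $\mathfrak m_A$-adic topology, and let $G$ be a locally profinite group (for example the group of rational points of a connected reductive group over a finite extension of $\mathbb Q_p$). An $A$-module $U$ is \emph{orthonormalizable} if it is $\mathfrak m_A$-adically complete and separated and $U/\mathfrak m_A^nU$ is free over $A/\mathfrak m_A^n$ for all $n$. An \emph{$\mathfrak m_A$-adically continuous} $A[G]$-module is an $\mathfrak m_A$-adically complete and separated $A$-module $\pi$ with an $A$-linear $G$-action such that $G\times\pi\to\pi$ is continuous for the $\mathfrak m_A$-adic topology on $\pi$. Let $\mathrm{Mod}_G^{\mathfrak m_A\text{-cont}}(A)^{\mathrm{fl}}$ be the category of orthonormalizable $\mathfrak m_A$-adically continuous $A[G]$-modules, with $A[G]$-linear maps. A \emph{profinite augmented representation} of $G$ over $A$ is a profinite linearly topologized $A$-module $M$ with an action of $G$ by continuous $A$-linear maps such that, for some compact open subgroup $K\subset G$, the $K$-action extends to a structure of topological module over $A[[K]]=\varprojlim_{K'}A[K/K']$ ($K'$ running over the open normal subgroups of $K$). It is \emph{topologically free} if $M\cong A^I$ as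 topological $A$-modules for some set $I$. Let $\mathrm{Mod}_G^{\mathrm{pro\,aug}}(A)^{\mathrm{fl}}$ be the category of topologically free profinite augmented representations, with continuous $A[G]$-linear maps. Then: (1) $\pi\mapsto\pi^\vee:=\mathrm{Hom}_A(\pi,A)$ (with the topology of pointwise convergence and the contragredient $G$-action) and $M\mapsto M^\vee:=\mathrm{Hom}_A^{\mathrm{cont}}(M,A)$ (with the contragredient $G$-action) define contravariant functors between $\mathrm{Mod}_G^{\mathfrak m_A\text{-cont}}(A)^{\mathrm{fl}}$ and $\mathrm{Mod}_G^{\mathrm{pro\,aug}}(A)^{\mathrm{fl}}$, which are anti-equivalences of categories, quasi-inverse to each other through the evaluation maps $\pi\to\pi^{\vee\vee}$ and $M\to M^{\vee\vee}$. (2) This anti-equivalence is compatible with base change: let $A\to A'$ be a local homomorphism to another complete Noetherian local ring with finite residue field, and put $\pi\mathbin{\widehat\otimes}_AA':=\varprojlim_n\pi\otimes_AA'/\mathfrak m_{A'}^n$ and $M\mathbin{\widehat\otimes}_AA':=\varprojlim_{N,\mathfrak a}M/N\otimes_AA'/\mathfrak a$, where $N\subset M$ runs over the open $A$-submodules and $\mathfrak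 a\subset A'$ over the open ideals. These functors take $\mathrm{Mod}_G^{\mathfrak m_A\text{-cont}}(A)^{\mathrm{fl}}$ to $\mathrm{Mod}_G^{\mathfrak m_{A'}\text{-cont}}(A')^{\mathrm{fl}}$ and $\mathrm{Mod}_G^{\mathrm{pro\,aug}}(A)^{\mathrm{fl}}$ to $\mathrm{Mod}_G^{\mathrm{pro\,aug}}(A')^{\mathrm{fl}}$, and for $\pi$ in $\mathrm{Mod}_G^{\mathfrak m_A\text{-cont}}(A)^{\mathrm{fl}}$ there is an isomorphism of topological $A'$-modules with $G$-action, natural in $\pi$, $$\mathrm{Hom}_A(\pi,A)\mathbin{\widehat\otimes}_AA'\;\cong\;\mathrm{Hom}_{A'}(\pi\mathbin{\widehat\otimes}_AA',A'),$$ which sends $f\otimes a$ to a linear form with $x\otimes b\mapsto ab\,f(x)$. -/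

import Mathlib

open CategoryTheory IsLocalRing TensorProduct Topology

universe u v w

noncomputable section

/-! ### Coefficient rings -/

/-- A complete Noetherian local ring with finite residue field, carrying its `𝔪`-adic topology. -/
class IsCompleteNoetherianLocal (A : Type u) [CommRing A] [TopologicalSpace A] : Prop
    extends IsTopologicalRing A, IsLocalRing A, IsNoetherianRing A where
  isAdicComplete : IsAdicComplete (maximalIdeal A) A
  finite_residueField : Finite (ResidueField A)
  isAdic : IsAdic (maximalIdeal A)

/-! ### Modules with the `𝔪`-adic topology -/

section AdicModules

variable (A : Type u) [CommRing A] [IsLocalRing A]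

/-- An `A`-module `U` is orthonormalizable if it is `𝔪`-adically complete and separated and each
`U / 𝔪ⁿ U` is free over `A / 𝔪ⁿ`. -/
def IsOrthonormalizable (U : Type v) [AddCommGroup U] [Module A U] : Prop :=
  IsAdicComplete (maximalIdeal A) U ∧
    ∀ n : ℕ, Module.Free (A ⧸ (maximalIdeal A) ^ n)
      (U ⧸ ((maximalIdeal A) ^ n • (⊤ : Submodule A U)))

variable {A} {G : Type w} [Group G] [TopologicalSpace G]

/-- An `A[G]`-module is `𝔪`-adically continuous if it is `𝔪`-adically complete and separated and
the action map `G × π → π` is continuous for the `𝔪`-adic topology on `π`. -/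
def IsAdicallyContinuous (π : Rep.{v} A G) : Prop :=
  IsAdicComplete (maximalIdeal A) π ∧
    letI : TopologicalSpace π := (maximalIdeal A).adicModuleTopology π
    Continuous fun p : G × π => π.ρ p.1 p.2

variable (A G)

/-- The orthonormalizable `𝔪`-adically continuous `A[G]`-modules, as a full subcategory of the
category of all `A[G]`-modules. -/
def contFl : ObjectProperty (Rep.{v} A G) := fun π =>
  IsAdicallyContinuous π ∧ IsOrthonormalizable A π

end AdicModules

/-! ### Completed group algebras and profinite augmented representations -/

section CompletedGroupAlgebra

variable (A : Type u) [CommRing A] (K : Type w) [Group K] [TopologicalSpace K]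

/-- The map `A[K/U] → A[K/V]` for open normal subgroups `U ≤ V`. -/
def groupAlgebraTransition {U V : OpenNormalSubgroup K} (h : U ≤ V) :
    MonoidAlgebra A (K ⧸ U.toSubgroup) →+* MonoidAlgebra A (K ⧸ V.toSubgroup) :=
  MonoidAlgebra.mapDomainRingHom A
    (QuotientGroup.map U.toSubgroup V.toSubgroup (MonoidHom.id K) h)

/-- The completed group algebra `A[[K]] = lim A[K/U]`, the limit being over the open normal
subgroups `U` of `K`, as a ring of compatible families. -/
def completedGroupAlgebraSubring :
    Subring (∀ U : OpenNormalSubgroup K, MonoidAlgebra A (K ⧸ U.toSubgroup)) where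
  carrier := {x | ∀ (U V : OpenNormalSubgroup K) (h : U ≤ V),
    groupAlgebraTransition A K h (x U) = x V}
  mul_mem' hx hy U V h := by simp [hx U V h, hy U V h]
  one_mem' U V h := by simp
  add_mem' hx hy U V h := by simp [hx U V h, hy U V h]
  zero_mem' U V h := by simp
  neg_mem' hx U V h := by simp [hx U V h]

/-- The completed group algebra `A[[K]]`. -/
abbrev CompletedGroupAlgebra : Type (max u w) := completedGroupAlgebraSubring A K

/-- The limit topology on `A[[K]]`, each `A[K/U]` having the product topology of its
coefficients. -/
instance [TopologicalSpace A] : TopologicalSpace (CompletedGroupAlgebra A K) :=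
  TopologicalSpace.induced
    (fun x (U : OpenNormalSubgroup K) (q : K ⧸ U.toSubgroup) => (x.1 U).coeff q) inferInstance

/-- The canonical map `A[K] → A[[K]]`. -/
def toCompletedGroupAlgebra : MonoidAlgebra A K →+* CompletedGroupAlgebra A K :=
  (RingHom.pi fun U : OpenNormalSubgroup K =>
    MonoidAlgebra.mapDomainRingHom A (QuotientGroup.mk' U.toSubgroup)).codRestrict _ (by
      intro x U V h
      exact congrArg (fun f : MonoidAlgebra A K →+* MonoidAlgebra A (K ⧸ V.toSubgroup) => f x)
        (MonoidAlgebra.mapDomainRingHom_comp (R := A)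
          (QuotientGroup.map U.toSubgroup V.toSubgroup (MonoidHom.id K) h)
          (QuotientGroup.mk' U.toSubgroup)).symm)

end CompletedGroupAlgebra

section Augmented

variable {A : Type u} [CommRing A] [TopologicalSpace A]
  {G : Type w} [Group G] [TopologicalSpace G]

/-- A profinite (linear-topological) `A`-module. -/
structure IsProfiniteModule (A : Type u) [CommRing A] (M : Type v) [AddCommGroup M]
    [Module A M] [TopologicalSpace M] : Prop where
  compactSpace : CompactSpace M
  t2Space : T2Space M
  totallyDisconnectedSpace : TotallyDisconnectedSpace M
  isLinearTopology : IsLinearTopology A M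

/-- `M` is topologically free if it is isomorphic, as a topological `A`-module, to a direct product
of copies of `A`. -/
def IsTopologicallyFree (A : Type u) [CommRing A] [TopologicalSpace A] (M : Type v)
    [AddCommGroup M] [Module A M] [TopologicalSpace M] : Prop :=
  ∃ I : Type v, Nonempty (M ≃L[A] (I → A))

/-- For some compact open subgroup `K` of `G`, the action of `K` on `M` extends to a structure of
topological `A[[K]]`-module on `M`. -/
def IsAugmented (M : TopRep.{v} A G) : Prop :=
  ∃ K : Subgroup G, IsOpen (K : Set G) ∧ IsCompact (K : Set G) ∧
    ∃ _ : Module (CompletedGroupAlgebra A K) M,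
      (∀ (x : MonoidAlgebra A K) (m : M), toCompletedGroupAlgebra A K x • m =
        Representation.asAlgebraHom (M.ρ.toRepresentation.comp K.subtype) x m) ∧
      Continuous fun p : CompletedGroupAlgebra A K × M => p.1 • p.2

/-- A profinite augmented representation of `G` over `A`. -/
def IsProfiniteAugmented (M : TopRep.{v} A G) : Prop :=
  IsProfiniteModule A M ∧ IsAugmented M

variable (A G)

/-- The topologically free profinite augmented `G`-representations over `A`, as a full subcategory
of the category of topological `A`-modules on which `G` acts by continuous `A`-linear maps; the
morphisms are the continuous `A[G]`-linear maps. -/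
def proAugFl : ObjectProperty (TopRep.{v} A G) := fun M =>
  IsProfiniteAugmented M ∧ IsTopologicallyFree A M

end Augmented

/-! ### The duality functors -/

section Duality

variable (A : Type u) [CommRing A]

/-- `Hom_A(U, A)`, to be given the topology of pointwise convergence. -/
def PointwiseDual (U : Type v) [AddCommGroup U] [Module A U] : Type (max u v) :=
  Module.Dual A U

namespace PointwiseDual

section
variable (U : Type v) [AddCommGroup U] [Module A U]

instance : AddCommGroup (PointwiseDual A U) := inferInstanceAs (AddCommGroup (Module.Dual A U))
instance : Module A (PointwiseDual A U) := inferInstanceAs (Module A (Module.Dual A U))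
instance : FunLike (PointwiseDual A U) U A := inferInstanceAs (FunLike (Module.Dual A U) U A)

/-- The inclusion of `Hom_A(U, A)` in the module of all functions `U → A`. -/
def incl : PointwiseDual A U →ₗ[A] (U → A) where
  toFun f x := f x
  map_add' _ _ := rfl
  map_smul' _ _ := rfl

variable [TopologicalSpace A]

/-- The topology of pointwise convergence. -/
instance : TopologicalSpace (PointwiseDual A U) :=
  TopologicalSpace.induced (incl A U) inferInstance

instance [IsTopologicalRing A] : IsTopologicalAddGroup (PointwiseDual A U) :=
  topologicalAddGroup_induced (incl A U)

instance [IsTopologicalRing A] : ContinuousSMul A (PointwiseDual A U) :=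
  continuousSMul_induced (incl A U)

end

variable {A}
variable {U : Type v} [AddCommGroup U] [Module A U]

@[ext] theorem ext {f g : PointwiseDual A U} (h : ∀ x, f x = g x) : f = g :=
  DFunLike.ext _ _ h

variable [TopologicalSpace A]

theorem continuous_eval (x : U) : Continuous fun f : PointwiseDual A U => f x :=
  (continuous_apply x).comp continuous_induced_dom

/-- The transpose `f ↦ f ∘ φ` of a linear map `φ`. -/
def map {U' : Type v} [AddCommGroup U'] [Module A U'] (φ : U →ₗ[A] U') :
    PointwiseDual A U' →L[A] PointwiseDual A U where
  toFun f := LinearMap.comp (M₃ := A) f φ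
  map_add' _ _ := rfl
  map_smul' _ _ := rfl
  cont := continuous_induced_rng.2 (continuous_pi fun x => continuous_eval (φ x))

@[simp] theorem map_apply {U' : Type v} [AddCommGroup U'] [Module A U'] (φ : U →ₗ[A] U')
    (f : PointwiseDual A U') (x : U) : map φ f x = f (φ x) := rfl

end PointwiseDual

variable [TopologicalSpace A] [IsTopologicalRing A] (G : Type w) [Group G]

/-- The contragredient action `(g f)(x) = f(g⁻¹ x)` on `Hom_A(π, A)`. -/
def contragredient (π : Rep.{v} A G) : ContRepresentation A G (PointwiseDual A π) :=
  .ofMonoidHom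
    { toFun := fun g => PointwiseDual.map (π.ρ g⁻¹)
      map_one' := by ext f x; simp
      map_mul' := fun g h => by ext f x; simp }

@[simp] theorem contragredient_apply (π : Rep.{v} A G) (g : G) (f : PointwiseDual A π) (x : π) :
    contragredient A G π g f x = f (π.ρ g⁻¹ x) := rfl

/-- The functor `π ↦ π^∨ = Hom_A(π, A)` (topology of pointwise convergence, contragredient
`G`-action). -/
def dualFunctor : (Rep.{u} A G)ᵒᵖ ⥤ TopRep.{u} A G where
  obj π := TopRep.of (contragredient A G π.unop)
  map φ := TopRep.ofHom
    { PointwiseDual.map φ.unop.hom.toLinearMap with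
      isIntertwining' := fun g => by
        ext f x
        exact congrArg f (Rep.hom_comm_apply φ.unop g⁻¹ x).symm }
  map_id _ := rfl
  map_comp _ _ := rfl

/-- The contragredient action `(g f)(m) = f(g⁻¹ m)` on `Hom_A^cont(M, A)`. -/
def contContragredient (M : TopRep.{v} A G) : Representation A G (M →L[A] A) where
  toFun g :=
    { toFun := fun f => f.comp (M.ρ g⁻¹)
      map_add' := fun _ _ => rfl
      map_smul' := fun _ _ => rfl }
  map_one' := by ext f m; simp
  map_mul' g h := by ext f m; simp only [mul_inv_rev, map_mul]; rfl

@[simp] theorem contContragredient_apply (M : TopRep.{v} A G) (g : G) (f : M →L[A] A) (m : M) :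
    contContragredient A G M g f m = f (M.ρ g⁻¹ m) := rfl

/-- The functor `M ↦ M^∨ = Hom_A^cont(M, A)` (contragredient `G`-action). -/
def contDualFunctor : (TopRep.{u} A G)ᵒᵖ ⥤ Rep.{u} A G where
  obj M := Rep.of (contContragredient A G M.unop)
  map φ := Rep.ofHom
    { toFun := fun f => f.comp φ.unop.hom.toContinuousLinearMap
      map_add' := fun _ _ => rfl
      map_smul' := fun _ _ => rfl
      isIntertwining' := fun g => by
        ext f x
        exact congrArg f (TopRep.hom_comm_apply φ.unop g⁻¹ x).symm }
  map_id _ := rfl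
  map_comp _ _ := rfl

/-- The evaluation map `π → Hom_A^cont(Hom_A(π, A), A)`, `x ↦ (f ↦ f x)`. -/
def evalRep (π : Rep.{u} A G) :
    π ⟶ (contDualFunctor A G).obj (.op ((dualFunctor A G).obj (.op π))) :=
  Rep.ofHom (ρ := π.ρ)
    (σ := contContragredient A G (TopRep.of (contragredient A G π)))
    { toFun := fun x =>
        { toFun := fun f : PointwiseDual A π => f x
          map_add' := fun _ _ => rfl
          map_smul' := fun _ _ => rfl
          cont := PointwiseDual.continuous_eval x }
      map_add' := fun x y => by
        ext f; exact map_add (show Module.Dual A π from f) x y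
      map_smul' := fun a x => by
        ext f; exact map_smul (show Module.Dual A π from f) a x
      isIntertwining' := fun g => by
        ext x f
        change f (π.ρ g x) = f (π.ρ g⁻¹⁻¹ x)
        rw [inv_inv] }

/-- The evaluation map `M → Hom_A(Hom_A^cont(M, A), A)`, `m ↦ (f ↦ f m)`. -/
def evalTopRep (M : TopRep.{u} A G) :
    M ⟶ (dualFunctor A G).obj (.op ((contDualFunctor A G).obj (.op M))) :=
  TopRep.ofHom (ρ := M.ρ)
    (σ := contragredient A G (Rep.of (contContragredient A G M)))
    { toFun := fun m => show Module.Dual A (M →L[A] A) from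
        { toFun := fun f => f m
          map_add' := fun _ _ => rfl
          map_smul' := fun _ _ => rfl }
      map_add' := fun x y => PointwiseDual.ext fun f => map_add f x y
      map_smul' := fun a x => PointwiseDual.ext fun f => map_smul f a x
      cont := continuous_induced_rng.2 (continuous_pi fun f => ContinuousLinearMap.continuous f)
      isIntertwining' := fun g => by
        refine ContinuousLinearMap.ext fun m =>
          PointwiseDual.ext (A := A) (U := M →L[A] A) fun f => ?_
        change f (M.ρ g m) = f (M.ρ g⁻¹⁻¹ m)
        rw [inv_inv] }

end Duality

/-! ### Base change -/

section QuotTensor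

variable {A : Type u} [CommRing A] {A' : Type u} [CommRing A'] [Algebra A A']
variable {U U' U'' : Type v} [AddCommGroup U] [Module A U] [AddCommGroup U'] [Module A U']
  [AddCommGroup U''] [Module A U'']

/-- The map `A'/I ⊗_A U → A'/J ⊗_A U'` induced by an inclusion `I ≤ J` and a linear map `φ`. -/
def quotTensorMap {I J : Ideal A'} (h : I ≤ J) (φ : U →ₗ[A] U') :
    (A' ⧸ I) ⊗[A] U →ₗ[A'] (A' ⧸ J) ⊗[A] U' :=
  AlgebraTensorModule.map (Submodule.factor h : (A' ⧸ I) →ₗ[A'] (A' ⧸ J)) φ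

theorem quotTensorMap_comp {I J L : Ideal A'} (h : I ≤ J) (h' : J ≤ L) (ψ : U' →ₗ[A] U'')
    (φ : U →ₗ[A] U') (x : (A' ⧸ I) ⊗[A] U) :
    quotTensorMap h' ψ (quotTensorMap h φ x) = quotTensorMap (h.trans h') (ψ ∘ₗ φ) x := by
  induction x using TensorProduct.induction_on with
  | zero => simp
  | add x y hx hy => rw [map_add, map_add, map_add, hx, hy]
  | tmul b m =>
    obtain ⟨b, rfl⟩ := Ideal.Quotient.mk_surjective b
    rfl

theorem quotTensorMap_id {I : Ideal A'} (x : (A' ⧸ I) ⊗[A] U) :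
    quotTensorMap (le_refl I) (LinearMap.id : U →ₗ[A] U) x = x := by
  induction x using TensorProduct.induction_on with
  | zero => simp
  | add x y hx hy => rw [map_add, hx, hy]
  | tmul b m =>
    obtain ⟨b, rfl⟩ := Ideal.Quotient.mk_surjective b
    rfl

end QuotTensor

section AdicBaseChange

variable (A : Type u) [CommRing A] (A' : Type u) [CommRing A'] [IsLocalRing A'] [Algebra A A']

/-- The map `A'/𝔪'ⁿ ⊗_A U → A'/𝔪'ᵐ ⊗_A U` for `m ≤ n`. -/
def adicTransition (U : Type v) [AddCommGroup U] [Module A U] {m n : ℕ} (h : m ≤ n) :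
    (A' ⧸ maximalIdeal A' ^ n) ⊗[A] U →ₗ[A'] (A' ⧸ maximalIdeal A' ^ m) ⊗[A] U :=
  quotTensorMap (Ideal.pow_le_pow_right h) LinearMap.id

/-- The completed tensor product `lim_n U ⊗_A A'/𝔪'ⁿ`, as a module of compatible families. -/
def adicBaseChange (U : Type v) [AddCommGroup U] [Module A U] :
    Submodule A' (∀ n : ℕ, (A' ⧸ maximalIdeal A' ^ n) ⊗[A] U) where
  carrier := {x | ∀ (m n : ℕ) (h : m ≤ n), adicTransition A A' U h (x n) = x m}
  add_mem' hx hy m n h := by simp [hx m n h, hy m n h]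
  zero_mem' m n h := by simp
  smul_mem' a x hx m n h := by simp [hx m n h]

variable {A}

/-- The map of completed tensor products induced by a linear map. -/
def adicBaseChangeMap {U U' : Type v} [AddCommGroup U] [Module A U] [AddCommGroup U']
    [Module A U'] (φ : U →ₗ[A] U') : adicBaseChange A A' U →ₗ[A'] adicBaseChange A A' U' where
  toFun x := ⟨fun n => quotTensorMap (le_refl _) φ (x.1 n), fun m n h => by
    have := x.2 m n h
    beta_reduce
    rw [← this, adicTransition, adicTransition, quotTensorMap_comp, quotTensorMap_comp,
      LinearMap.id_comp, LinearMap.comp_id]⟩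
  map_add' x y := Subtype.ext <| funext fun n => by simp
  map_smul' a x := Subtype.ext <| funext fun n => by simp

theorem adicBaseChangeMap_id (U : Type v) [AddCommGroup U] [Module A U] :
    adicBaseChangeMap A' (LinearMap.id : U →ₗ[A] U) = LinearMap.id :=
  LinearMap.ext fun x => Subtype.ext <| funext fun n => quotTensorMap_id (x.1 n)

theorem adicBaseChangeMap_comp {U U' U'' : Type v} [AddCommGroup U] [Module A U]
    [AddCommGroup U'] [Module A U'] [AddCommGroup U''] [Module A U'']
    (ψ : U' →ₗ[A] U'') (φ : U →ₗ[A] U') :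
    adicBaseChangeMap A' (ψ ∘ₗ φ) = adicBaseChangeMap A' ψ ∘ₗ adicBaseChangeMap A' φ :=
  LinearMap.ext fun x => Subtype.ext <| funext fun n =>
    (quotTensorMap_comp le_rfl le_rfl ψ φ (x.1 n)).symm

/-- The base change functor `π ↦ π ⊗̂_A A'` on `A[G]`-modules, `G` acting through `π`. -/
def adicBaseChangeFunctor (G : Type w) [Group G] : Rep.{u} A G ⥤ Rep.{u} A' G where
  obj π := Rep.of (X := adicBaseChange A A' π)
    { toFun := fun g => adicBaseChangeMap A' (π.ρ g)
      map_one' := by rw [map_one]; exact adicBaseChangeMap_id A' π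
      map_mul' := fun g h => by rw [map_mul]; exact adicBaseChangeMap_comp A' _ _ }
  map φ := Rep.ofHom
    { adicBaseChangeMap A' φ.hom.toLinearMap with
      isIntertwining' := fun g => by
        refine (adicBaseChangeMap_comp A' _ _).symm.trans
          (Eq.trans ?_ (adicBaseChangeMap_comp A' _ _))
        rw [φ.hom.isIntertwining'] }
  map_id π := Rep.hom_ext (Representation.IntertwiningMap.ext (adicBaseChangeMap_id A' π))
  map_comp φ ψ := Rep.hom_ext (Representation.IntertwiningMap.ext
    (adicBaseChangeMap_comp A' ψ.hom.toLinearMap φ.hom.toLinearMap))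

/-- The element `x ⊗ b` of `π ⊗̂_A A'`. -/
def adicTmul {G : Type w} [Group G] (π : Rep.{u} A G) (x : π) (b : A') :
    (adicBaseChangeFunctor A' G).obj π :=
  show adicBaseChange A A' π from ⟨fun _ => Ideal.Quotient.mk _ b ⊗ₜ x, fun _ _ _ => rfl⟩

end AdicBaseChange

section ProBaseChange

variable (A : Type u) [CommRing A] (A' : Type u) [CommRing A'] [Algebra A A']

/-- The map `M/N ⊗_A A'/𝔞 → M/N' ⊗_A A'/𝔞'` for `N ≤ N'` and `𝔞 ≤ 𝔞'`. -/
def proTransition (M : Type v) [AddCommGroup M] [Module A M] {N N' : Submodule A M}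
    {𝔞 𝔞' : Ideal A'} (hN : N ≤ N') (h𝔞 : 𝔞 ≤ 𝔞') :
    (A' ⧸ 𝔞) ⊗[A] (M ⧸ N) →ₗ[A'] (A' ⧸ 𝔞') ⊗[A] (M ⧸ N') :=
  quotTensorMap h𝔞 (Submodule.factor hN)

theorem smul_eq_zero_of_mem_ideal (M : Type v) [AddCommGroup M] [Module A M] {N : Submodule A M} {𝔞 : Ideal A'} {a : A'} (ha : a ∈ 𝔞)
    (x : (A' ⧸ 𝔞) ⊗[A] (M ⧸ N)) : a • x = 0 := by
  induction x using TensorProduct.induction_on with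
  | zero => simp
  | add x y hx hy => rw [smul_add, hx, hy, add_zero]
  | tmul b m =>
    obtain ⟨b, rfl⟩ := Ideal.Quotient.mk_surjective b
    rw [TensorProduct.smul_tmul']
    have : a • (Ideal.Quotient.mk 𝔞 b) = 0 :=
      (Ideal.Quotient.eq_zero_iff_mem (I := 𝔞) (a := a * b)).2 (𝔞.mul_mem_right b ha)
    rw [this, TensorProduct.zero_tmul]

variable [TopologicalSpace A']

/-- Pairs `(N, 𝔞)` of an open `A`-submodule of `M` and an open ideal of `A'`. -/
abbrev OpenPair (M : Type v) [AddCommGroup M] [Module A M] [TopologicalSpace M] : Type (max u v) :=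
  {N : Submodule A M // IsOpen (N : Set M)} × {𝔞 : Ideal A' // IsOpen (𝔞 : Set A')}

/-- The completed tensor product `lim M/N ⊗_A A'/𝔞`, the limit being over the open `A`-submodules
`N` of `M` and the open ideals `𝔞` of `A'`, as a module of compatible families. -/
def proBaseChange (M : Type v) [AddCommGroup M] [Module A M] [TopologicalSpace M] :
    Submodule A' (∀ p : OpenPair A A' M, (A' ⧸ p.2.1) ⊗[A] (M ⧸ p.1.1)) where
  carrier := {x | ∀ (p q : OpenPair A A' M) (h₁ : p.1.1 ≤ q.1.1) (h₂ : p.2.1 ≤ q.2.1),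
    proTransition A A' M h₁ h₂ (x p) = x q}
  add_mem' hx hy p q h₁ h₂ := by simp [hx p q h₁ h₂, hy p q h₁ h₂]
  zero_mem' p q h₁ h₂ := by simp
  smul_mem' a x hx p q h₁ h₂ := by simp [hx p q h₁ h₂]

section
variable (M : Type v) [AddCommGroup M] [Module A M] [TopologicalSpace M]

/-- The projection to `M/N ⊗_A A'/𝔞`. -/
def proBaseChangeProj (p : OpenPair A A' M) :
    proBaseChange A A' M →ₗ[A'] (A' ⧸ p.2.1) ⊗[A] (M ⧸ p.1.1) :=
  LinearMap.proj p ∘ₗ (proBaseChange A A' M).subtype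

/-- The limit topology, each `M/N ⊗_A A'/𝔞` being discrete. -/
instance proBaseChangeTopology : TopologicalSpace (proBaseChange A A' M) :=
  ⨅ p : OpenPair A A' M, TopologicalSpace.induced (proBaseChangeProj A A' M p) ⊥

theorem continuous_proBaseChangeProj (p : OpenPair A A' M) :
    @Continuous _ _ _ ⊥ (proBaseChangeProj A A' M p) :=
  continuous_iff_le_induced.2 (iInf_le _ p)

instance : IsTopologicalAddGroup (proBaseChange A A' M) :=
  topologicalAddGroup_iInf fun p => by
    let : TopologicalSpace ((A' ⧸ p.2.1) ⊗[A] (M ⧸ p.1.1)) := ⊥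
    have : DiscreteTopology ((A' ⧸ p.2.1) ⊗[A] (M ⧸ p.1.1)) := ⟨rfl⟩
    exact topologicalAddGroup_induced (proBaseChangeProj A A' M p)

instance [IsTopologicalRing A'] : ContinuousSMul A' (proBaseChange A A' M) :=
  continuousSMul_iInf fun p => by
    let : TopologicalSpace ((A' ⧸ p.2.1) ⊗[A] (M ⧸ p.1.1)) := ⊥
    have : DiscreteTopology ((A' ⧸ p.2.1) ⊗[A] (M ⧸ p.1.1)) := ⟨rfl⟩
    have : ContinuousSMul A' ((A' ⧸ p.2.1) ⊗[A] (M ⧸ p.1.1)) := ⟨by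
      rw [continuous_iff_continuousAt]
      rintro ⟨a, x⟩
      refine tendsto_nhds_of_eventually_eq ?_
      have h1 : ∀ᶠ b in 𝓝 a, b - a ∈ p.2.1 := by
        have hc : Continuous fun b : A' => b - a := by fun_prop
        exact hc.continuousAt.preimage_mem_nhds (by simpa using p.2.2.mem_nhds p.2.1.zero_mem)
      have h2 : ∀ᶠ y in 𝓝 x, y = x := by simp
      rw [nhds_prod_eq]
      filter_upwards [h1.prod_mk h2] with q hq
      obtain ⟨hb, hy⟩ := hq
      have := smul_eq_zero_of_mem_ideal A A' M hb x
      change q.1 • q.2 = a • x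
      rw [hy, ← sub_add_cancel q.1 a]
      exact (add_smul (q.1 - a) a x).trans (by rw [this, zero_add])⟩
    exact continuousSMul_induced (proBaseChangeProj A A' M p)

end

variable {A}

/-- The inverse image of a pair `(N, 𝔞)` under a continuous linear map. -/
def OpenPair.comap [TopologicalSpace A] {M M' : Type v} [AddCommGroup M] [Module A M]
    [TopologicalSpace M] [AddCommGroup M'] [Module A M'] [TopologicalSpace M'] (φ : M →L[A] M')
    (p : OpenPair A A' M') : OpenPair A A' M :=
  (⟨p.1.1.comap φ.toLinearMap, p.1.2.preimage φ.continuous⟩, p.2)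

variable [TopologicalSpace A]

/-- The map `M/φ⁻¹(N) ⊗_A A'/𝔞 → M'/N ⊗_A A'/𝔞` induced by `φ`. -/
def proBaseChangeComponent {M M' : Type v} [AddCommGroup M] [Module A M]
    [TopologicalSpace M] [AddCommGroup M'] [Module A M'] [TopologicalSpace M'] (φ : M →L[A] M')
    (p : OpenPair A A' M') :
    (A' ⧸ (p.comap A' φ).2.1) ⊗[A] (M ⧸ (p.comap A' φ).1.1) →ₗ[A'] (A' ⧸ p.2.1) ⊗[A] (M' ⧸ p.1.1) :=
  quotTensorMap (le_refl p.2.1) (Submodule.mapQ (p.1.1.comap φ.toLinearMap) p.1.1 φ.toLinearMap le_rfl)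

/-- The continuous map of completed tensor products induced by a continuous linear map `φ`: its
component at `(N, 𝔞)` is induced by the map `M/φ⁻¹(N) → M'/N`. -/
def proBaseChangeMap {M M' : Type v} [AddCommGroup M] [Module A M]
    [TopologicalSpace M] [AddCommGroup M'] [Module A M'] [TopologicalSpace M'] (φ : M →L[A] M') :
    proBaseChange A A' M →L[A'] proBaseChange A A' M' where
  toFun x := ⟨fun p => proBaseChangeComponent A' φ p (x.1 (p.comap A' φ)), fun p q h₁ h₂ => by
    have := x.2 (p.comap A' φ) (q.comap A' φ) (Submodule.comap_mono h₁) h₂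
    beta_reduce
    rw [← this]
    refine (quotTensorMap_comp _ _ _ _ _).trans (Eq.trans ?_ (quotTensorMap_comp _ _ _ _ _).symm)
    congr 2
    ext m
    rfl⟩
  map_add' x y := Subtype.ext <| funext fun p => map_add (proBaseChangeComponent A' φ p) _ _
  map_smul' a x := Subtype.ext <| funext fun p => map_smul (proBaseChangeComponent A' φ p) a _
  cont := continuous_iInf_rng.2 fun p => continuous_induced_rng.2 <|
    @Continuous.comp _ _ _ _ ⊥ ⊥ _ (proBaseChangeComponent A' φ p) continuous_bot
      (continuous_proBaseChangeProj A A' M (p.comap A' φ))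

theorem proBaseChangeMap_id (M : Type v) [AddCommGroup M] [Module A M] [TopologicalSpace M] :
    proBaseChangeMap A' (ContinuousLinearMap.id A M) = ContinuousLinearMap.id A' _ :=
  ContinuousLinearMap.ext fun x => Subtype.ext <| funext fun p => by
    refine Eq.trans ?_ (quotTensorMap_id (x.1 p))
    change quotTensorMap (le_refl p.2.1) (Submodule.mapQ p.1.1 p.1.1 LinearMap.id le_rfl) (x.1 p) = _
    rw [Submodule.mapQ_id]

theorem proBaseChangeMap_comp {M M' M'' : Type v} [AddCommGroup M] [Module A M]
    [TopologicalSpace M] [AddCommGroup M'] [Module A M'] [TopologicalSpace M']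
    [AddCommGroup M''] [Module A M''] [TopologicalSpace M'']
    (ψ : M' →L[A] M'') (φ : M →L[A] M') :
    proBaseChangeMap A' (ψ ∘L φ) = proBaseChangeMap A' ψ ∘L proBaseChangeMap A' φ :=
  ContinuousLinearMap.ext fun x => Subtype.ext <| funext fun p => by
    refine Eq.trans ?_ (quotTensorMap_comp _ _ _ _ _).symm
    change quotTensorMap _ _ (x.1 ((p.comap A' ψ).comap A' φ)) = _
    congr 2
    ext m
    rfl

/-- The base change functor `M ↦ M ⊗̂_A A'` on topological `A`-modules with an action of `G`. -/
def proBaseChangeFunctor [IsTopologicalRing A'] (G : Type w) [Group G] :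
    TopRep.{u} A G ⥤ TopRep.{u} A' G where
  obj M := TopRep.of (X := proBaseChange A A' M) (.ofMonoidHom
    { toFun := fun g => proBaseChangeMap A' (M.ρ g)
      map_one' := by rw [map_one]; exact proBaseChangeMap_id A' M
      map_mul' := fun g h => by rw [map_mul]; exact proBaseChangeMap_comp A' _ _ })
  map φ := TopRep.ofHom
    { proBaseChangeMap A' φ.hom.toContinuousLinearMap with
      isIntertwining' := fun g => by
        refine (proBaseChangeMap_comp A' _ _).symm.trans
          (Eq.trans ?_ (proBaseChangeMap_comp A' _ _))
        rw [φ.hom.isIntertwining'] }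
  map_id M := TopRep.hom_ext (ContIntertwiningMap.ext (proBaseChangeMap_id A' M))
  map_comp φ ψ := TopRep.hom_ext (ContIntertwiningMap.ext
    (proBaseChangeMap_comp A' ψ.hom.toContinuousLinearMap φ.hom.toContinuousLinearMap))

/-- The element `m ⊗ b` of `M ⊗̂_A A'`. -/
def proTmul [IsTopologicalRing A'] {G : Type w} [Group G] (M : TopRep.{u} A G) (m : M) (b : A') :
    (proBaseChangeFunctor A' G).obj M :=
  show proBaseChange A A' M from
    ⟨fun _ => Ideal.Quotient.mk _ b ⊗ₜ Submodule.Quotient.mk m, fun _ _ _ _ => rfl⟩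

end ProBaseChange

/-- The value at `x ∈ π` of an element of the dual `π^∨ = Hom_A(π, A)`. -/
def dualApply {A : Type u} [CommRing A] [TopologicalSpace A] [IsTopologicalRing A]
    {G : Type w} [Group G] (π : Rep.{u} A G) (f : (dualFunctor A G).obj (.op π)) (x : π) : A :=
  (show PointwiseDual A π from f) x

/-! ### The induced functors on the full subcategories -/

section Restrict

variable (A : Type u) [CommRing A] [TopologicalSpace A] [IsTopologicalRing A] [IsLocalRing A]
  (G : Type w) [Group G] [TopologicalSpace G]

/-- The functor `π ↦ π^∨` from orthonormalizable `𝔪`-adically continuous modules to topologically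
free profinite augmented representations, given that it takes the former to the latter. -/
def dualFl (h : ∀ π : Rep.{u} A G, contFl A G π → proAugFl A G ((dualFunctor A G).obj (.op π))) :
    (contFl.{u} A G).FullSubcategoryᵒᵖ ⥤ (proAugFl.{u} A G).FullSubcategory :=
  (proAugFl A G).lift ((contFl A G).ι.op ⋙ dualFunctor A G)
    fun X => h X.unop.obj X.unop.property

/-- The functor `M ↦ M^∨` from topologically free profinite augmented representations to
orthonormalizable `𝔪`-adically continuous modules, given that it takes the former to the latter. -/
def contDualFl
    (h : ∀ M : TopRep.{u} A G, proAugFl A G M → contFl A G ((contDualFunctor A G).obj (.op M))) :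
    (proAugFl.{u} A G).FullSubcategoryᵒᵖ ⥤ (contFl.{u} A G).FullSubcategory :=
  (contFl A G).lift ((proAugFl A G).ι.op ⋙ contDualFunctor A G)
    fun X => h X.unop.obj X.unop.property

end Restrict

end

/-! Both categories are governed by one explicit pairing. Let c₀(I, A) (`NullFamily`) be the module
of families in A tending to zero. For c in c₀(I, A) and any g in A^I the sum ∑ cᵢ gᵢ converges. This
pairing identifies A^I topologically with Hom_A(c₀(I, A), A) (`pointwiseDualEquiv`) and c₀(I, A)
with Hom_A^cont(A^I, A) (`contDualEquiv`). Linear forms on c₀(I, A) need no continuity hypothesis: a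
linear map carries 𝔪ⁿU into 𝔪ⁿV, and finite families are dense. Since A is compact, a continuous
bijection out of A^I onto a Hausdorff module is a homeomorphism.

The orthonormalizable modules are exactly those isomorphic to some c₀(I, A): lift a basis of U/𝔪U,
and use freeness of every U/𝔪ⁿU to see that the lifts form a basis at each level (`exists_equiv`).
Both evaluation maps thus become isomorphisms in coordinates (`isIso_evalRep`, `isIso_evalTopRep`).

The conditions on the G-action are exchanged by compactness. If K × M → M is continuous and M is
compact, the tube lemma makes f(km) - f(m) small uniformly in m, which is 𝔪-adic continuity on the
dual (`contFl_contDual`). Conversely, for a compact open K the K-orbit of a vector of π is finite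
modulo 𝔪ⁿ. So the pointwise dual has arbitrarily small K-stable open submodules N such that some
open normal V acts trivially modulo N (`PointwiseDual.hasLevels`). Then A[K/V] acts modulo N, and
compactness assembles these actions into a continuous action of A[[K]] (`HasLevels.module`,
`HasLevels.continuous_act`).

For base change, c₀(I, A) ⊗̂ A' is c₀(I, A') and A^I ⊗̂ A' is A'^I, compatibly with the pairings.
The resulting isomorphism is built from coordinates, but its values on the f ⊗ a and x ⊗ 1 determine
it and do not involve them, so it is natural and equivariant. Stability of the augmented side under
base change is then deduced from that of the adic side by biduality. -/

noncomputable section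

/-! ### Topology of the coefficient ring -/

namespace IsCompleteNoetherianLocal

variable {A : Type u} [CommRing A] [TopologicalSpace A] [IsCompleteNoetherianLocal A]

instance : IsAdicComplete (maximalIdeal A) A := isAdicComplete

theorem isOpen_maximalIdeal_pow (n : ℕ) : IsOpen ((maximalIdeal A ^ n : Ideal A) : Set A) :=
  (isAdic_iff.1 (isAdic (A := A))).1 n

theorem hasBasis_nhds_zero :
    (𝓝 (0 : A)).HasBasis (fun _ : ℕ => True) fun n => ((maximalIdeal A ^ n : Ideal A) : Set A) :=
  (isAdic (A := A)).hasBasis_nhds_zero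

theorem exists_pow_subset {s : Set A} (hs : s ∈ 𝓝 (0 : A)) :
    ∃ n : ℕ, ((maximalIdeal A ^ n : Ideal A) : Set A) ⊆ s := by
  simpa using hasBasis_nhds_zero.mem_iff.1 hs

instance : NonarchimedeanRing A where
  is_nonarchimedean U hU := by
    obtain ⟨n, hn⟩ := exists_pow_subset hU
    exact ⟨⟨(maximalIdeal A ^ n).toAddSubgroup, isOpen_maximalIdeal_pow n⟩, hn⟩

theorem eq_zero_of_forall_mem_pow {a : A} (h : ∀ n : ℕ, a ∈ maximalIdeal A ^ n) : a = 0 :=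
  IsHausdorff.haus (I := maximalIdeal A) inferInstance a fun n => by
    simpa [SModEq.zero] using h n

theorem eq_of_forall_sub_mem_pow {a b : A} (h : ∀ n : ℕ, a - b ∈ maximalIdeal A ^ n) : a = b :=
  sub_eq_zero.1 (eq_zero_of_forall_mem_pow h)

theorem exists_limit {a : ℕ → A} (h : ∀ m n, m ≤ n → a n - a m ∈ maximalIdeal A ^ m) :
    ∃ l, ∀ n, l - a n ∈ maximalIdeal A ^ n := by
  obtain ⟨l, hl⟩ := IsPrecomplete.prec (I := maximalIdeal A) (M := A) inferInstance (f := a)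
    fun {m n} hmn => by
      rw [SModEq.comm, SModEq.sub_mem]
      simpa using h m n hmn
  refine ⟨l, fun n => ?_⟩
  have := (hl n).symm
  rw [SModEq.sub_mem] at this
  simpa using this

instance (n : ℕ) : Finite (A ⧸ maximalIdeal A ^ n) := by
  have : Finite (A ⧸ maximalIdeal A) := finite_residueField (A := A)
  exact Ideal.finite_quotient_pow (IsNoetherian.noetherian _) n

instance : T2Space A := by
  let : UniformSpace A := IsTopologicalAddGroup.rightUniformSpace A
  have : IsUniformAddGroup A := isUniformAddGroup_of_addCommGroup
  exact ((isAdic (A := A)).isAdicComplete_iff.1 inferInstance).2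

/-- A is complete, and totally bounded because every A/𝔪ⁿ is finite. Compactness of A, hence of A^I,
later makes inverses of continuous bijections continuous. -/
instance : CompactSpace A := by
  let : UniformSpace A := IsTopologicalAddGroup.rightUniformSpace A
  have : IsUniformAddGroup A := isUniformAddGroup_of_addCommGroup
  have hc : CompleteSpace A := ((isAdic (A := A)).isAdicComplete_iff.1 inferInstance).1
  refine ⟨isCompact_iff_totallyBounded_isComplete.2 ⟨?_, completeSpace_iff_isComplete_univ.1 hc⟩⟩
  rw [totallyBounded_iff_subset_finite_iUnion_nhds_zero]
  intro U hU
  obtain ⟨n, hn⟩ := exists_pow_subset hU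
  have : Finite (A ⧸ maximalIdeal A ^ n) := inferInstance
  refine ⟨Set.range fun q : A ⧸ maximalIdeal A ^ n => Quotient.out q, Set.finite_range _,
    fun a _ => ?_⟩
  refine Set.mem_iUnion₂.2 ⟨_, ⟨Ideal.Quotient.mk _ a, rfl⟩, ?_⟩
  refine Set.mem_vadd_set.2 ⟨a - Quotient.out (Ideal.Quotient.mk (maximalIdeal A ^ n) a), hn ?_,
    by simp⟩
  exact (Ideal.Quotient.mk_eq_mk_iff_sub_mem _ _).1 (Ideal.Quotient.mk_out _).symm

/-- In a complete nonarchimedean group a family is summable as soon as it tends to zero along the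
cofinite filter. -/
theorem summable_of_finite_notMem_pow {I : Type v} {a : I → A}
    (h : ∀ n : ℕ, {i | a i ∉ maximalIdeal A ^ n}.Finite) : Summable a := by
  let : UniformSpace A := IsTopologicalAddGroup.rightUniformSpace A
  have : IsUniformAddGroup A := isUniformAddGroup_of_addCommGroup
  have hc : CompleteSpace A := ((isAdic (A := A)).isAdicComplete_iff.1 inferInstance).1
  refine NonarchimedeanAddGroup.summable_of_tendsto_cofinite_zero ?_
  rw [hasBasis_nhds_zero.tendsto_right_iff]
  exact fun n _ => h n

theorem isClosed_maximalIdeal_pow (n : ℕ) : IsClosed ((maximalIdeal A ^ n : Ideal A) : Set A) :=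
  AddSubgroup.isClosed_of_isOpen (maximalIdeal A ^ n).toAddSubgroup (isOpen_maximalIdeal_pow n)

theorem tsum_mem_pow {I : Type v} {a : I → A} {n : ℕ} (h : ∀ i, a i ∈ maximalIdeal A ^ n) :
    ∑' i, a i ∈ maximalIdeal A ^ n :=
  tsum_mem (s := maximalIdeal A ^ n) (isClosed_maximalIdeal_pow n) h

theorem map_maximalIdeal_pow_le {A' : Type u} [CommRing A'] [IsLocalRing A'] [Algebra A A']
    [IsLocalHom (algebraMap A A')] {n : ℕ} {a : A} (ha : a ∈ maximalIdeal A ^ n) :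
    algebraMap A A' a ∈ maximalIdeal A' ^ n := by
  have h : (maximalIdeal A).map (algebraMap A A') ≤ maximalIdeal A' :=
    ((IsLocalRing.local_hom_TFAE (algebraMap A A')).out 0 2).1 ‹_›
  have := Ideal.mem_map_of_mem (algebraMap A A') ha
  rw [Ideal.map_pow] at this
  exact Ideal.pow_right_mono h n this

end IsCompleteNoetherianLocal

/-! ### Null families, the model of orthonormalizable modules -/

open IsCompleteNoetherianLocal

/-- This is the source of automatic continuity: linear maps are continuous for the adic topologies.
-/
theorem map_mem_ideal_smul_top {A U V : Type*} [CommRing A] [AddCommGroup U] [Module A U]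
    [AddCommGroup V] [Module A V] (f : U →ₗ[A] V) {J : Ideal A} {x : U}
    (hx : x ∈ J • (⊤ : Submodule A U)) : f x ∈ J • (⊤ : Submodule A V) := by
  have := Submodule.mem_map_of_mem (f := f) hx
  rw [Submodule.map_smul''] at this
  exact Submodule.smul_mono le_rfl le_top this

/-- The module of families of elements of `A` that tend to zero. -/
def NullFamily (A : Type u) [CommRing A] [IsLocalRing A] (I : Type v) : Submodule A (I → A) where
  carrier := {c | ∀ n : ℕ, {i | c i ∉ maximalIdeal A ^ n}.Finite}
  add_mem' {c d} hc hd n := ((hc n).union (hd n)).subset fun i hi => by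
    by_contra h
    simp only [Set.mem_union, Set.mem_ofPred_eq, not_or, not_not] at h
    exact hi (add_mem h.1 h.2)
  zero_mem' n := by simp
  smul_mem' a c hc n := (hc n).subset fun i hi h => hi (Ideal.mul_mem_left _ a h)

namespace NullFamily

section Single
variable {A : Type u} [CommRing A] [IsLocalRing A] {I : Type v}

open Classical in
/-- The family with value `a` at `i` and zero elsewhere. -/
def single (i : I) : A →ₗ[A] NullFamily A I :=
  (LinearMap.single A (fun _ : I => A) i).codRestrict _ fun a n =>
    (Set.finite_singleton i).subset fun j hj => by
      by_contra h
      have h : j ≠ i := h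
      exact hj (by simp [Pi.single_eq_of_ne h])

open Classical in
theorem coe_single (i : I) (a : A) : (single i a : I → A) = Pi.single i a := rfl

theorem single_eq_smul (i : I) (a : A) : single i a = a • single i 1 := by
  rw [← map_smul, smul_eq_mul, mul_one]

variable (c : NullFamily A I) (n : ℕ)

/-- The finite set of indices where a null family is not in `𝔪ⁿ`. -/
def supp : Finset I := (c.2 n).toFinset

variable {c n}

theorem apply_mem {i : I} (h : i ∉ supp c n) : c.1 i ∈ maximalIdeal A ^ n := by
  by_contra h'
  exact h ((c.2 n).mem_toFinset.2 h')

theorem sub_sum_single_apply_mem {s : Finset I} (hs : ∀ i ∉ s, c.1 i ∈ maximalIdeal A ^ n)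
    (i : I) : (c - ∑ j ∈ s, single j (c.1 j)).1 i ∈ maximalIdeal A ^ n := by
  classical
  have : (c - ∑ j ∈ s, single j (c.1 j)).1 i = c.1 i - if i ∈ s then c.1 i else 0 := by
    rw [Submodule.coe_sub, Submodule.coe_sum]
    simp [coe_single, Finset.sum_apply, Pi.single_apply]
  rw [this]
  split_ifs with h
  · simp
  · simpa using hs i h

end Single

variable {A : Type u} [CommRing A] [TopologicalSpace A] [IsCompleteNoetherianLocal A] {I : Type v}

/-- Noetherianity enters here. Each entry is expanded in a fixed finite generating set of 𝔪ⁿ. The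
coefficients must be chosen as small as the entry allows, so that the coefficient families are again
null. -/
theorem mem_pow_smul_top {n : ℕ} {c : NullFamily A I} :
    c ∈ maximalIdeal A ^ n • (⊤ : Submodule A (NullFamily A I)) ↔
      ∀ i, c.1 i ∈ maximalIdeal A ^ n := by
  classical
  refine ⟨fun h i => ?_, fun h => ?_⟩
  · refine Submodule.smul_induction_on h (fun a ha d _ => ?_) fun x y hx hy => ?_
    · exact Ideal.mul_mem_right _ _ ha
    · exact add_mem hx hy
  obtain ⟨s, hs⟩ := (IsNoetherian.noetherian (maximalIdeal A ^ n) : (maximalIdeal A ^ n).FG)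
  -- One choice of b has to serve every k. It is made at the largest k with a in 𝔪^(k+n), which
  -- exists unless a = 0.
  have key : ∀ a : A, a ∈ maximalIdeal A ^ n → ∃ b : A → A, a = ∑ t ∈ s, b t * t ∧
      ∀ k : ℕ, a ∈ maximalIdeal A ^ (k + n) → ∀ t, b t ∈ maximalIdeal A ^ k := by
    have aux : ∀ k : ℕ, ∀ a : A, a ∈ maximalIdeal A ^ (k + n) → ∃ b : A → A,
        a = ∑ t ∈ s, b t * t ∧ ∀ t, b t ∈ maximalIdeal A ^ k := by
      intro k a ha
      rw [pow_add, ← smul_eq_mul] at ha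
      refine Submodule.smul_induction_on ha (fun x hx y hy => ?_) ?_
      · rw [← hs, Submodule.mem_span_finset] at hy
        obtain ⟨d, -, rfl⟩ := hy
        refine ⟨fun t => x * d t, ?_, fun t => Ideal.mul_mem_right _ _ hx⟩
        simp only [smul_eq_mul, Finset.mul_sum, mul_assoc]
      · rintro _ _ ⟨b, rfl, hb⟩ ⟨b', rfl, hb'⟩
        exact ⟨b + b', by simp [add_mul, Finset.sum_add_distrib], fun t => add_mem (hb t) (hb' t)⟩
    intro a ha
    by_cases h0 : a = 0
    · exact ⟨0, by simp [h0], fun k _ t => zero_mem _⟩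
    have hex : ∃ k : ℕ, a ∉ maximalIdeal A ^ (k + n) := by
      by_contra hcon
      push Not at hcon
      exact h0 (eq_zero_of_forall_mem_pow fun k => Ideal.pow_le_pow_right (by lia) (hcon k))
    have hpos : Nat.find hex ≠ 0 := fun h => Nat.find_spec hex (by rw [h, zero_add]; exact ha)
    obtain ⟨k, hk⟩ := Nat.exists_eq_succ_of_ne_zero hpos
    obtain ⟨b, hb, hb'⟩ := aux k a (not_not.1 (Nat.find_min hex (m := k) (by lia)))
    refine ⟨b, hb, fun l hl t => ?_⟩
    have : l ≤ k := by
      by_contra hlt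
      exact Nat.find_spec hex (Ideal.pow_le_pow_right (by lia) hl)
    exact Ideal.pow_le_pow_right this (hb' t)
  choose b hb hb' using fun i => key (c.1 i) (h i)
  have : c = ∑ t ∈ s, t • (⟨fun i => b i t, fun k => (c.2 (k + n)).subset fun i hi h' =>
      hi (hb' i k h' t)⟩ : NullFamily A I) := by
    ext i
    rw [Submodule.coe_sum, Finset.sum_apply, hb i]
    exact Finset.sum_congr rfl fun t _ => mul_comm _ _
  rw [this]
  refine Submodule.sum_mem _ fun t ht => Submodule.smul_mem_smul ?_ trivial
  rw [← hs]
  exact Submodule.subset_span ht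

instance : IsAdicComplete (maximalIdeal A) (NullFamily A I) where
  haus' c hc := by
    ext i
    refine eq_zero_of_forall_mem_pow fun n => ?_
    exact mem_pow_smul_top.1 (SModEq.zero.1 (hc n)) i
  prec' c hc := by
    have hc' : ∀ i m n, m ≤ n → (c n).1 i - (c m).1 i ∈ maximalIdeal A ^ m := fun i m n h =>
      mem_pow_smul_top.1 (SModEq.sub_mem.1 (hc h).symm) i
    choose l hl using fun i => exists_limit (hc' i)
    -- The limit agrees with the n-th term modulo 𝔪ⁿ, so it leaves 𝔪ⁿ only where that term does.
    have hl0 : l ∈ NullFamily A I := fun n => ((c n).2 n).subset fun i hi h => hi <| by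
      simpa using add_mem (hl i n) h
    refine ⟨⟨l, hl0⟩, fun n => (SModEq.sub_mem.2 (mem_pow_smul_top.2 fun i => hl i n)).symm⟩

/-- Reduction modulo `𝔪ⁿ`, as a finitely supported family. -/
def reduce (n : ℕ) : NullFamily A I →ₗ[A] (I →₀ A ⧸ maximalIdeal A ^ n) where
  toFun c := Finsupp.ofSupportFinite (fun i => Ideal.Quotient.mk _ (c.1 i))
    ((c.2 n).subset fun i hi h => hi (Ideal.Quotient.eq_zero_iff_mem.2 h))
  map_add' c d := by ext i; rfl
  map_smul' a c := by ext i; rfl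

theorem reduce_apply (n : ℕ) (c : NullFamily A I) (i : I) :
    reduce n c i = Ideal.Quotient.mk _ (c.1 i) := rfl

theorem ker_reduce (n : ℕ) :
    LinearMap.ker (reduce n) = maximalIdeal A ^ n • (⊤ : Submodule A (NullFamily A I)) := by
  ext c
  rw [mem_pow_smul_top, LinearMap.mem_ker, Finsupp.ext_iff]
  exact forall_congr' fun i => Ideal.Quotient.eq_zero_iff_mem

theorem reduce_single (n : ℕ) (i : I) (a : A) :
    reduce n (single i a) = Finsupp.single i (Ideal.Quotient.mk _ a) := by
  classical
  ext j
  rw [reduce_apply, coe_single, Pi.single_apply, Finsupp.single_apply]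
  simp only [eq_comm (a := i)]
  split_ifs <;> simp

theorem reduce_surjective (n : ℕ) : Function.Surjective (reduce (A := A) (I := I) n) := by
  rw [← LinearMap.range_eq_top, eq_top_iff]
  intro x _
  induction x using Finsupp.induction_linear with
  | zero => exact zero_mem _
  | add x y hx hy => exact add_mem (hx trivial) (hy trivial)
  | single i a =>
    obtain ⟨a, rfl⟩ := Ideal.Quotient.mk_surjective a
    exact ⟨single i a, reduce_single n i a⟩

theorem isOrthonormalizable_of_equiv {U : Type w} [AddCommGroup U] [Module A U]
    (e : U ≃ₗ[A] NullFamily A I) : IsOrthonormalizable A U := by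
  have hmap : ∀ n : ℕ, (maximalIdeal A ^ n • (⊤ : Submodule A U)).map (e : U →ₗ[A] NullFamily A I) =
      maximalIdeal A ^ n • ⊤ := fun n => by
    rw [Submodule.map_smul'', Submodule.map_top, LinearEquiv.range]
  have hmem : ∀ (n : ℕ) (x : U), x ∈ maximalIdeal A ^ n • (⊤ : Submodule A U) ↔
      e x ∈ maximalIdeal A ^ n • (⊤ : Submodule A (NullFamily A I)) := fun n x => by
    rw [← hmap]
    refine ⟨fun h => ⟨x, h, rfl⟩, ?_⟩
    rintro ⟨y, hy, hxy⟩
    rwa [← e.injective hxy]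
  refine ⟨{ haus' := fun x hx => ?_, prec' := fun f hf => ?_ }, fun n => ?_⟩
  · refine e.map_eq_zero_iff.1 (IsHausdorff.haus (I := maximalIdeal A) inferInstance _ fun n => ?_)
    exact SModEq.zero.2 ((hmem n x).1 (SModEq.zero.1 (hx n)))
  · obtain ⟨l, hl⟩ := IsPrecomplete.prec (I := maximalIdeal A) (M := NullFamily A I) inferInstance
      (f := fun n => e (f n)) fun {m n} hmn => by
        rw [SModEq.sub_mem, ← map_sub, ← hmem]
        exact SModEq.sub_mem.1 (hf hmn)
    refine ⟨e.symm l, fun n => ?_⟩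
    rw [SModEq.sub_mem, hmem, map_sub, e.apply_symm_apply]
    exact SModEq.sub_mem.1 (hl n)
  · let φ : (U ⧸ maximalIdeal A ^ n • (⊤ : Submodule A U)) ≃ₗ[A] (I →₀ A ⧸ maximalIdeal A ^ n) :=
      (Submodule.quotEquivOfEq _ _ (by
        ext x; rw [hmem, ← ker_reduce]; rfl)).trans
      (((reduce n).comp (e : U →ₗ[A] NullFamily A I)).quotKerEquivOfSurjective
        ((reduce_surjective n).comp e.surjective))
    exact Module.Free.of_equiv
      (φ.extendScalarsOfSurjective (S := A ⧸ maximalIdeal A ^ n) Ideal.Quotient.mk_surjective).symm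

end NullFamily

/-! ### Duality between c₀(I, A) and A^I -/

instance {A : Type u} [CommRing A] [TopologicalSpace A] [T2Space A] (U : Type v) [AddCommGroup U]
    [Module A U] : T2Space (PointwiseDual A U) :=
  .of_injective_continuous (f := PointwiseDual.incl A U) DFunLike.coe_injective
    continuous_induced_dom

namespace NullFamily

variable {A : Type u} [CommRing A] [TopologicalSpace A] [IsCompleteNoetherianLocal A] {I : Type v}

theorem summable_mul (c : NullFamily A I) (g : I → A) : Summable fun i => c.1 i * g i :=
  summable_of_finite_notMem_pow fun n =>
    (c.2 n).subset fun _ hi h => hi (Ideal.mul_mem_right _ _ h)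

/-- The pairing `(c, g) ↦ ∑ cᵢ gᵢ` between null families and arbitrary families. -/
def pairing : NullFamily A I →ₗ[A] (I → A) →ₗ[A] A :=
  LinearMap.mk₂ A (fun c g => ∑' i, c.1 i * g i)
    (fun c d g => by
      rw [← (summable_mul c g).tsum_add (summable_mul d g)]
      exact tsum_congr fun i => add_mul _ _ _)
    (fun a c g => by
      rw [smul_eq_mul, ← (summable_mul c g).tsum_mul_left]
      exact tsum_congr fun i => mul_assoc _ _ _)
    (fun c g h => by
      rw [← (summable_mul c g).tsum_add (summable_mul c h)]
      exact tsum_congr fun i => mul_add _ _ _)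
    (fun a c g => by
      rw [smul_eq_mul, ← (summable_mul c g).tsum_mul_left]
      exact tsum_congr fun i => mul_left_comm _ _ _)

theorem pairing_apply (c : NullFamily A I) (g : I → A) : pairing c g = ∑' i, c.1 i * g i := rfl

theorem pairing_mem {c : NullFamily A I} {g : I → A} {n : ℕ}
    (h : ∀ i, c.1 i * g i ∈ maximalIdeal A ^ n) : pairing c g ∈ maximalIdeal A ^ n :=
  tsum_mem_pow h

@[simp] theorem pairing_single_left (i : I) (a : A) (g : I → A) :
    pairing (single i a) g = a * g i := by
  classical
  rw [pairing_apply, tsum_eq_single i fun j hj => by simp [coe_single, hj]]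
  simp [coe_single]

open Classical in
@[simp] theorem pairing_single_right (c : NullFamily A I) (i : I) (a : A) :
    pairing c (Pi.single i a) = c.1 i * a := by
  rw [pairing_apply, tsum_eq_single i fun j hj => by simp [hj]]
  simp

/-- Modulo 𝔪ⁿ only the finitely many coordinates of g in `supp c n` contribute. -/
theorem continuous_pairing (c : NullFamily A I) : Continuous (pairing c) := by
  refine continuous_of_continuousAt_zero (pairing c) ?_
  rw [ContinuousAt, map_zero, hasBasis_nhds_zero.tendsto_right_iff]
  intro n _
  have : (⋂ i ∈ supp c n, {g : I → A | g i ∈ maximalIdeal A ^ n}) ∈ 𝓝 (0 : I → A) := by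
    rw [Filter.biInter_finset_mem]
    exact fun i _ => ((isOpen_maximalIdeal_pow n).preimage (continuous_apply i)).mem_nhds
      (zero_mem (maximalIdeal A ^ n))
  filter_upwards [this] with g hg
  refine pairing_mem fun i => ?_
  by_cases hi : i ∈ supp c n
  · exact Ideal.mul_mem_left _ _ (Set.mem_iInter₂.1 hg i hi)
  · exact Ideal.mul_mem_right _ _ (apply_mem hi)

/-- The difference of the two sides vanishes on finite families, and c is a finite family plus an
element of 𝔪ⁿ c₀(I, A), which any linear form sends into 𝔪ⁿ. Letting n grow gives equality. -/
theorem eq_pairing (f : NullFamily A I →ₗ[A] A) (c : NullFamily A I) :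
    f c = pairing c fun i => f (single i 1) := by
  refine eq_of_forall_sub_mem_pow fun n => ?_
  let h : NullFamily A I →ₗ[A] A := f - pairing.flip fun i => f (single i 1)
  have hh : ∀ i a, h (single i a) = 0 := fun i a => by
    change f (single i a) - pairing (single i a) _ = 0
    rw [pairing_single_left, single_eq_smul, map_smul, smul_eq_mul, sub_self]
  change h c ∈ _
  have hc := map_mem_ideal_smul_top h (mem_pow_smul_top.2
    (sub_sum_single_apply_mem (c := c) (n := n) (s := supp c n) fun i hi => apply_mem hi))
  simpa [map_sub, map_sum, hh] using hc

/-- `Hom_A(c₀(I, A), A)` is the product `A^I`. -/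
def pointwiseDualEquiv : (I → A) ≃L[A] PointwiseDual A (NullFamily A I) :=
  let φ : (I → A) →ₗ[A] PointwiseDual A (NullFamily A I) :=
    { toFun := fun g => (pairing.flip g : Module.Dual A (NullFamily A I))
      map_add' := fun g h => map_add pairing.flip g h
      map_smul' := fun a g => map_smul pairing.flip a g }
  have hφ : Continuous φ :=
    continuous_induced_rng.2 (continuous_pi fun c => continuous_pairing c)
  have hb : Function.Bijective φ :=
    ⟨fun g h hgh => funext fun i => by
      have : pairing (single i 1) g = pairing (single i 1) h := DFunLike.congr_fun hgh (single i 1)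
      simpa using this,
    fun f => ⟨fun i => f (single i 1),
      PointwiseDual.ext fun c => (eq_pairing (show Module.Dual A (NullFamily A I) from f) c).symm⟩⟩
  { LinearEquiv.ofBijective φ hb with
    continuous_toFun := hφ
    -- A^I is compact and the pointwise dual is Hausdorff.
    continuous_invFun := Continuous.continuous_symm_of_equiv_compact_to_t2
      (f := (LinearEquiv.ofBijective φ hb).toEquiv) hφ }

/-- A neighbourhood of zero in A^I constrains finitely many coordinates only, so it contains all but
finitely many of the standard vectors. -/
theorem coe_mem_of_continuous (f : (I → A) →L[A] A) [DecidableEq I] :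
    (fun i => f (Pi.single i 1)) ∈ NullFamily A I := by
  intro n
  have h : f ⁻¹' ((maximalIdeal A ^ n : Ideal A) : Set A) ∈ 𝓝 (0 : I → A) :=
    ((isOpen_maximalIdeal_pow n).preimage f.continuous).mem_nhds (by simp)
  rw [nhds_pi, Filter.mem_pi] at h
  obtain ⟨s, hs, t, ht, hst⟩ := h
  refine hs.subset fun i hi => ?_
  by_contra his
  refine hi (hst fun j hj => ?_)
  have : j ≠ i := fun h => his (h ▸ hj)
  rw [Pi.single_eq_of_ne this]
  exact mem_of_mem_nhds (ht j)

/-- In the product topology g is the sum of its coordinate vectors, and f commutes with convergent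
sums. -/
theorem continuousLinearMap_eq_pairing [DecidableEq I] (f : (I → A) →L[A] A) (g : I → A) :
    f g = pairing ⟨_, coe_mem_of_continuous f⟩ g := by
  have h : HasSum (fun i => Pi.single i (g i)) g := by
    rw [Pi.hasSum]
    intro i
    have := hasSum_single (f := fun j => (Pi.single j (g j) : I → A) i) i
      fun j hj => Pi.single_eq_of_ne hj.symm _
    simpa using this
  rw [pairing_apply, ← (h.mapL f).tsum_eq]
  refine tsum_congr fun i => ?_
  rw [mul_comm, ← smul_eq_mul, ← map_smul, ← Pi.single_smul, smul_eq_mul, mul_one]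

/-- `Hom_A^cont(A^I, A)` is the module of null families. -/
def contDualEquiv : NullFamily A I ≃ₗ[A] ((I → A) →L[A] A) := by
  classical
  exact
  { toFun := fun c => ⟨pairing c, continuous_pairing c⟩
    map_add' := fun c d => by ext g; simp
    map_smul' := fun a c => by ext g; simp
    invFun := fun f => ⟨_, coe_mem_of_continuous f⟩
    left_inv := fun c => by ext i; simp
    right_inv := fun f => by ext g; exact (continuousLinearMap_eq_pairing f g).symm }

theorem contDualEquiv_apply (c : NullFamily A I) (g : I → A) :
    contDualEquiv c g = pairing c g := rfl

end NullFamily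

/-! ### Structure of orthonormalizable modules -/

namespace IsOrthonormalizable

open NullFamily

variable {A : Type u} [CommRing A] [TopologicalSpace A] [IsCompleteNoetherianLocal A]
  {U : Type v} [AddCommGroup U] [Module A U] {I : Type w} (e : I → U)

variable (A) in
/-- The map `(A/𝔪ⁿ)^(I) → U/𝔪ⁿU` given by a family of elements of `U`. -/
def combination (n : ℕ) : (I →₀ A ⧸ maximalIdeal A ^ n) →ₗ[A ⧸ maximalIdeal A ^ n]
    U ⧸ (maximalIdeal A ^ n • (⊤ : Submodule A U)) :=
  Finsupp.linearCombination _ fun i => Submodule.Quotient.mk (e i)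

variable {e}

theorem combination_reduce {n : ℕ} (c : NullFamily A I) {s : Finset I}
    (hs : ∀ i ∉ s, c.1 i ∈ maximalIdeal A ^ n) :
    combination A e n (reduce n c) = Submodule.Quotient.mk (∑ i ∈ s, c.1 i • e i) := by
  rw [combination, Finsupp.linearCombination_apply, Finsupp.sum_of_support_subset (s := s)]
  · rw [← Submodule.mkQ_apply, map_sum]
    rfl
  · intro i hi
    by_contra h
    exact Finsupp.mem_support_iff.1 hi (Ideal.Quotient.eq_zero_iff_mem.2 (hs i h))
  · simp

/-- By induction U = span(e) + 𝔪ⁿU: multiplying U = span(e) + 𝔪U by 𝔪ⁿ puts 𝔪ⁿU inside span(e) +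
𝔪ⁿ⁺¹U. -/
theorem combination_surjective
    (h1 : Submodule.span A (Set.range e) ⊔ maximalIdeal A • (⊤ : Submodule A U) = ⊤) (n : ℕ) :
    Function.Surjective (combination A e n) := by
  have h : ∀ n : ℕ, Submodule.span A (Set.range e) ⊔ maximalIdeal A ^ n • (⊤ : Submodule A U) = ⊤ := by
    intro n
    induction n with
    | zero => simp
    | succ n ih =>
      refine top_le_iff.1 (ih.symm.le.trans (sup_le le_sup_left ?_))
      conv_lhs => rw [← h1]
      rw [Submodule.smul_sup, ← Submodule.mul_smul, ← pow_succ]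
      exact sup_le (Submodule.smul_le_right.trans le_sup_left) le_sup_right
  intro y
  obtain ⟨y, rfl⟩ := Submodule.Quotient.mk_surjective _ y
  obtain ⟨x, hx, z, hz, rfl⟩ := Submodule.mem_sup.1 ((h n).symm ▸ Submodule.mem_top (x := y))
  rw [← Set.image_univ, Finsupp.mem_span_image_iff_linearCombination] at hx
  obtain ⟨c, -, rfl⟩ := hx
  classical
  refine ⟨reduce n (∑ i ∈ c.support, single i (c i)), ?_⟩
  have hz' : (Submodule.Quotient.mk z : U ⧸ (maximalIdeal A ^ n • (⊤ : Submodule A U))) = 0 :=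
    (Submodule.Quotient.mk_eq_zero _).2 hz
  rw [Submodule.Quotient.mk_add, hz', add_zero, map_sum, map_sum, Finsupp.linearCombination_apply,
    Finsupp.sum, ← Submodule.mkQ_apply, map_sum]
  refine Finset.sum_congr rfl fun i _ => ?_
  rw [reduce_single, combination, Finsupp.linearCombination_single]
  rfl

/-- The surjection onto the free module U/𝔪ⁿU splits, so its kernel is a direct summand. Injectivity
modulo 𝔪 puts the kernel inside 𝔪 times the whole module, hence inside 𝔪 times itself. As 𝔪 is
nilpotent on A/𝔪ⁿ, the kernel is zero. -/
theorem combination_injective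
    (hfree : ∀ n : ℕ, Module.Free (A ⧸ maximalIdeal A ^ n)
      (U ⧸ (maximalIdeal A ^ n • (⊤ : Submodule A U))))
    (h1 : Submodule.span A (Set.range e) ⊔ maximalIdeal A • (⊤ : Submodule A U) = ⊤)
    (h2 : Function.Injective (combination A e 1)) (n : ℕ) :
    Function.Injective (combination A e n) := by
  rcases Nat.eq_zero_or_pos n with rfl | hn
  · have : Subsingleton (A ⧸ maximalIdeal A ^ 0) :=
      Ideal.Quotient.subsingleton_iff.2 (by simp)
    exact Function.injective_of_subsingleton _
  have := hfree n
  obtain ⟨s, hs⟩ := Module.projective_lifting_property (combination A e n) LinearMap.id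
    (combination_surjective h1 n)
  let L : (I →₀ A ⧸ maximalIdeal A ^ n) →ₗ[A] U ⧸ (maximalIdeal A ^ n • (⊤ : Submodule A U)) :=
    (combination A e n).restrictScalars A
  -- P is the projection onto the kernel along the image of the section s.
  let P : (I →₀ A ⧸ maximalIdeal A ^ n) →ₗ[A] (I →₀ A ⧸ maximalIdeal A ^ n) :=
    LinearMap.id - (s.restrictScalars A) ∘ₗ L
  have hP : LinearMap.range P ≤ LinearMap.ker L := by
    rintro _ ⟨x, rfl⟩
    have := LinearMap.congr_fun hs (combination A e n x)
    change combination A e n (x - s (combination A e n x)) = 0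
    rw [map_sub]
    exact sub_eq_zero.2 this.symm
  have hP' : ∀ x ∈ LinearMap.ker L, P x = x := fun x hx => by
    change x - s (combination A e n x) = x
    rw [show combination A e n x = 0 from hx, map_zero, sub_zero]
  have key : LinearMap.ker L ≤ maximalIdeal A • LinearMap.ker L := by
    intro x hx
    obtain ⟨c, rfl⟩ := reduce_surjective n x
    have hc : c ∈ maximalIdeal A ^ 1 • (⊤ : Submodule A (NullFamily A I)) := by
      rw [← ker_reduce, LinearMap.mem_ker]
      apply h2
      -- The same finite sum represents the images of c at levels 1 and n, so vanishing at level n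
      -- passes to level 1; this needs n ≥ 1.
      rw [map_zero, combination_reduce c (s := supp c n ) fun i hi =>
        Ideal.pow_le_pow_right hn (apply_mem hi)]
      have h0 : combination A e n (reduce n c) = 0 := hx
      rw [combination_reduce c (s := supp c n) fun i hi => apply_mem hi,
        Submodule.Quotient.mk_eq_zero] at h0
      rw [Submodule.Quotient.mk_eq_zero]
      exact Submodule.smul_mono_left (Ideal.pow_le_pow_right hn) h0
    rw [← hP' _ hx]
    rw [pow_one] at hc
    have := Submodule.mem_map_of_mem (f := P ∘ₗ reduce n) hc
    rw [Submodule.map_smul''] at this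
    refine Submodule.smul_mono le_rfl ?_ this
    rintro _ ⟨d, -, rfl⟩
    exact hP ⟨_, rfl⟩
  have key' : ∀ k : ℕ, LinearMap.ker L ≤ maximalIdeal A ^ k • LinearMap.ker L := by
    intro k
    induction k with
    | zero => simp
    | succ k ih =>
      rw [pow_succ, Submodule.mul_smul]
      exact ih.trans (Submodule.smul_mono le_rfl key)
  rw [injective_iff_map_eq_zero]
  intro x hx
  refine Submodule.smul_induction_on (p := fun x => x = 0) (key' n (show x ∈ LinearMap.ker L from hx))
    (fun a ha y _ => ?_) fun y z hy hz => by rw [hy, hz, add_zero]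
  ext i
  rw [Finsupp.smul_apply, Algebra.smul_def]
  exact (congrArg (· * y i) (Ideal.Quotient.eq_zero_iff_mem.2 ha)).trans (zero_mul _)

variable (A U) in
/-- An orthonormalizable module is isomorphic to a module of null families. -/
theorem exists_equiv (hU : IsOrthonormalizable A U) :
    ∃ I : Type v, Nonempty (NullFamily A I ≃ₗ[A] U) := by
  obtain ⟨hU, hfree⟩ := hU
  have := hfree 1
  have hN : Nontrivial (A ⧸ maximalIdeal A ^ 1) :=
    Ideal.Quotient.nontrivial_iff.2 (by rw [pow_one]; exact (maximalIdeal.isMaximal A).ne_top)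
  obtain ⟨⟨I, b⟩⟩ := Module.Free.exists_basis (A ⧸ maximalIdeal A ^ 1)
    (U ⧸ (maximalIdeal A ^ 1 • (⊤ : Submodule A U)))
  choose e he using fun i => Submodule.Quotient.mk_surjective _ (b i)
  have hcomb : combination A e 1 = Finsupp.linearCombination _ b :=
    congrArg (Finsupp.linearCombination (A ⧸ maximalIdeal A ^ 1)) (funext he)
  have h2 : Function.Injective (combination A e 1) := hcomb ▸ b.linearIndependent
  have h1 : Submodule.span A (Set.range e) ⊔ maximalIdeal A • (⊤ : Submodule A U) = ⊤ := by
    rw [eq_top_iff]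
    intro x _
    obtain ⟨y, hy⟩ : ∃ y, combination A e 1 y = Submodule.Quotient.mk x :=
      ⟨b.repr (Submodule.Quotient.mk x), hcomb ▸ b.linearCombination_repr _⟩
    obtain ⟨c, rfl⟩ := reduce_surjective 1 y
    rw [combination_reduce c (s := supp c 1) fun i hi => apply_mem hi, Submodule.Quotient.eq] at hy
    rw [pow_one] at hy
    rw [← sub_sub_cancel (∑ i ∈ supp c 1, c.1 i • e i) x]
    exact sub_mem (Submodule.mem_sup_left (Submodule.sum_mem _ fun i _ =>
      Submodule.smul_mem _ _ (Submodule.subset_span ⟨i, rfl⟩))) (Submodule.mem_sup_right hy)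
  let f : ∀ n : ℕ, NullFamily A I →ₗ[A] U ⧸ (maximalIdeal A ^ n • (⊤ : Submodule A U)) := fun n =>
    (combination A e n).restrictScalars A ∘ₗ reduce n
  have hf : ∀ {m n : ℕ} (hle : m ≤ n), Submodule.factorPow (maximalIdeal A) U hle ∘ₗ f n = f m := by
    intro m n hle
    ext c
    change Submodule.factorPow (maximalIdeal A) U hle (combination A e n (reduce n c)) =
      combination A e m (reduce m c)
    rw [combination_reduce c (s := supp c n) fun i hi => apply_mem hi,
      combination_reduce c (s := supp c n) fun i hi => Ideal.pow_le_pow_right hle (apply_mem hi)]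
    rfl
  -- Completeness of U glues the maps to the U/𝔪ⁿU into one map c₀(I, A) → U.
  let σ := IsAdicComplete.lift (maximalIdeal A) f hf
  have hσ : ∀ n c, Submodule.Quotient.mk (σ c) = combination A e n (reduce n c) := fun n c =>
    IsAdicComplete.mk_lift (maximalIdeal A) hf n c
  refine ⟨I, ⟨LinearEquiv.ofBijective σ ⟨?_, ?_⟩⟩⟩
  · rw [injective_iff_map_eq_zero]
    intro c hc
    ext i
    refine eq_zero_of_forall_mem_pow fun n => ?_
    have := hσ n c
    rw [hc, Submodule.Quotient.mk_zero] at this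
    have := combination_injective hfree h1 h2 n (this.symm.trans (map_zero _).symm)
    exact Ideal.Quotient.eq_zero_iff_mem.1 (DFunLike.congr_fun this i)
  -- Surjectivity modulo 𝔪 suffices, because the source is complete and the target separated.
  · refine surjective_of_mkQ_comp_surjective (I := maximalIdeal A) fun y => ?_
    obtain ⟨x, rfl⟩ := Submodule.Quotient.mk_surjective _ y
    obtain ⟨z, hz⟩ := combination_surjective h1 1 (Submodule.Quotient.mk x)
    obtain ⟨c, rfl⟩ := reduce_surjective 1 z
    refine ⟨c, ?_⟩
    rw [← hσ 1, Submodule.Quotient.eq, pow_one] at hz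
    exact (Submodule.Quotient.eq _).2 hz

end IsOrthonormalizable

/-! ### Continuity of group actions for the adic topology -/

section AdicContinuity

theorem hasBasis_nhds_adicModuleTopology {A : Type u} [CommRing A] (I : Ideal A) (U : Type v) [AddCommGroup U] [Module A U]
    (x : U) : (@nhds U (I.adicModuleTopology U) x).HasBasis (fun _ : ℕ => True)
      fun n => {y | y - x ∈ I ^ n • (⊤ : Submodule A U)} := by
  let := I.adicTopology
  have hb := (I.ringFilterBasis.moduleFilterBasis
    (I.adic_module_basis U)).toAddGroupFilterBasis.nhds_hasBasis x
  refine hb.to_hasBasis ?_ fun n _ => ⟨_, ⟨n, rfl⟩, ?_⟩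
  · rintro _ ⟨n, rfl⟩
    exact ⟨n, trivial, fun y hy => ⟨y - x, hy, by simp⟩⟩
  · rintro _ ⟨y, hy, rfl⟩
    change x + y - x ∈ I ^ n • (⊤ : Submodule A U)
    rwa [add_sub_cancel_left]

/-- Each g acts linearly, so it preserves every 𝔪ⁿπ. This equicontinuity reduces joint continuity to
continuity of the orbit maps at 1. -/
theorem isAdicallyContinuous_iff {A : Type u} [CommRing A] [IsLocalRing A] {G : Type w} [Group G] [TopologicalSpace G]
    [IsTopologicalGroup G] (π : Rep.{v} A G) :
    IsAdicallyContinuous π ↔ IsAdicComplete (maximalIdeal A) π ∧ ∀ (x : π) (n : ℕ),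
      ∀ᶠ g in 𝓝 (1 : G), π.ρ g x - x ∈ maximalIdeal A ^ n • (⊤ : Submodule A π) := by
  refine and_congr_right fun _ => ?_
  let : TopologicalSpace π := (maximalIdeal A).adicModuleTopology π
  have hb := hasBasis_nhds_adicModuleTopology (maximalIdeal A) π
  refine ⟨fun h x n => ?_, fun h => ?_⟩
  · have hc : Filter.Tendsto (fun g : G => π.ρ g x) (𝓝 1) (𝓝 x) := by
      have : Continuous fun g : G => π.ρ g x :=
        h.comp (continuous_id.prodMk (continuous_const (y := x)))
      simpa using this.tendsto 1
    exact hc ((hb x).mem_of_mem (i := n) trivial)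
  · refine continuous_iff_continuousAt.2 fun ⟨g, x⟩ => ?_
    rw [ContinuousAt, (hb _).tendsto_right_iff]
    intro n _
    have h1 : ∀ᶠ g' in 𝓝 g, π.ρ (g⁻¹ * g') x - x ∈ maximalIdeal A ^ n • (⊤ : Submodule A π) := by
      have : Filter.Tendsto (fun g' : G => g⁻¹ * g') (𝓝 g) (𝓝 1) := by
        have : Continuous fun g' : G => g⁻¹ * g' := by fun_prop
        simpa using this.tendsto g
      exact this (h x n)
    have h2 : ∀ᶠ y in 𝓝 x, y - x ∈ maximalIdeal A ^ n • (⊤ : Submodule A π) :=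
      (hb x).mem_of_mem (i := n) trivial
    rw [nhds_prod_eq]
    filter_upwards [h1.prod_mk h2] with ⟨g', y⟩ ⟨hg, hy⟩
    have : π.ρ g' y - π.ρ g x = π.ρ g' (y - x) + π.ρ g (π.ρ (g⁻¹ * g') x - x) := by
      have : π.ρ g' x = π.ρ g (π.ρ (g⁻¹ * g') x) := by
        rw [← Module.End.mul_apply, ← map_mul, mul_inv_cancel_left]
      rw [map_sub, map_sub, ← this, sub_add_sub_cancel]
    change π.ρ g' y - π.ρ g x ∈ _
    rw [this]
    exact add_mem (map_mem_ideal_smul_top _ hy) (map_mem_ideal_smul_top _ hg)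

end AdicContinuity

/-- Coefficients in A[K/V] are locally constant in k since K/V is discrete. Along this map a
continuous A[[K]]-action restricts to a continuous map K × M → M. -/
theorem continuous_toCompletedGroupAlgebra_of (A : Type u) [CommRing A] [TopologicalSpace A]
    (K : Type w) [Group K] [TopologicalSpace K] [IsTopologicalGroup K] :
    Continuous fun k : K => toCompletedGroupAlgebra A K (MonoidAlgebra.of A K k) := by
  refine continuous_induced_rng.2 (continuous_pi fun V => continuous_pi fun q => ?_)
  have : DiscreteTopology (K ⧸ V.toSubgroup) := QuotientGroup.discreteTopology V.isOpen'
  have h : Continuous fun r : K ⧸ V.toSubgroup => (MonoidAlgebra.single r (1 : A)).coeff q :=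
    continuous_of_discreteTopology
  convert h.comp (continuous_quot_mk : Continuous (QuotientGroup.mk : K → K ⧸ V.toSubgroup)) using 2 with k
  change (MonoidAlgebra.mapDomainRingHom A (QuotientGroup.mk' V.toSubgroup)
    (MonoidAlgebra.of A K k)).coeff q = _
  simp
  rfl

/-! ### The continuous dual is adically continuous -/

section ContDual

variable {A : Type u} [CommRing A] [TopologicalSpace A] [IsCompleteNoetherianLocal A]
  {G : Type w} [Group G]

/-- The continuous dual of a module isomorphic to a product `A^I`. -/
def contDualNullFamilyEquiv {M : Type v} [AddCommGroup M] [Module A M] [TopologicalSpace M]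
    {I : Type v} (μ : M ≃L[A] (I → A)) : (M →L[A] A) ≃ₗ[A] NullFamily A I :=
  LinearEquiv.trans
    { toFun := fun f => f.comp (μ.symm : (I → A) →L[A] M)
      invFun := fun f => f.comp (μ : M →L[A] (I → A))
      map_add' := fun _ _ => rfl
      map_smul' := fun _ _ => rfl
      left_inv := fun f => by ext; simp
      right_inv := fun f => by ext; simp }
    NullFamily.contDualEquiv.symm

theorem pairing_contDualNullFamilyEquiv {M : Type v} [AddCommGroup M] [Module A M]
    [TopologicalSpace M] {I : Type v} (μ : M ≃L[A] (I → A)) (f : M →L[A] A) (m : M) :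
    NullFamily.pairing (contDualNullFamilyEquiv μ f) (μ m) = f m := by
  rw [← NullFamily.contDualEquiv_apply, contDualNullFamilyEquiv, LinearEquiv.trans_apply,
    LinearEquiv.apply_symm_apply]
  exact congrArg f (μ.symm_apply_apply m)

/-- The coordinates of f as a null family are its values at the standard vectors, so
`mem_pow_smul_top` applies. This turns a uniform estimate on M into an adic one on the dual. -/
theorem mem_pow_smul_top_of_forall_apply_mem {M : Type v} [AddCommGroup M] [Module A M]
    [TopologicalSpace M] {I : Type v} (μ : M ≃L[A] (I → A)) {f : M →L[A] A} {n : ℕ}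
    (h : ∀ m, f m ∈ maximalIdeal A ^ n) :
    f ∈ maximalIdeal A ^ n • (⊤ : Submodule A (M →L[A] A)) := by
  classical
  rw [← (contDualNullFamilyEquiv μ).symm_apply_apply f]
  refine map_mem_ideal_smul_top (contDualNullFamilyEquiv μ).symm.toLinearMap
    (NullFamily.mem_pow_smul_top.2 fun i => ?_)
  have := pairing_contDualNullFamilyEquiv μ f (μ.symm (Pi.single i 1))
  rw [ContinuousLinearEquiv.apply_symm_apply, NullFamily.pairing_single_right, mul_one] at this
  rw [this]
  exact h _

theorem contFl_contDual [TopologicalSpace G] [IsTopologicalGroup G] (M : TopRep.{u} A G)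
    (hM : proAugFl A G M) : contFl A G ((contDualFunctor A G).obj (.op M)) := by
  obtain ⟨⟨hprof, K, hKo, hKc, hmod, hext, hcont⟩, I, ⟨μ⟩⟩ := hM
  have hortho : IsOrthonormalizable A (M →L[A] A) :=
    NullFamily.isOrthonormalizable_of_equiv (contDualNullFamilyEquiv μ)
  refine ⟨(isAdicallyContinuous_iff _).2 ⟨hortho.1, fun (f : M →L[A] A) n => ?_⟩, hortho⟩
  have := hprof.compactSpace
  have hKM : Continuous fun p : K × M => f (M.ρ (p.1 : G) p.2) - f p.2 := by
    have h1 : Continuous fun p : K × M =>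
        toCompletedGroupAlgebra A K (MonoidAlgebra.of A K p.1) • p.2 :=
      hcont.comp (((continuous_toCompletedGroupAlgebra_of A K).comp continuous_fst).prodMk
        continuous_snd)
    have h2 : ∀ p : K × M, toCompletedGroupAlgebra A K (MonoidAlgebra.of A K p.1) • p.2 =
        M.ρ (p.1 : G) p.2 := fun p => by
      rw [hext, Representation.asAlgebraHom_of]; rfl
    simp_rw [h2] at h1
    exact (f.continuous.comp h1).sub (f.continuous.comp continuous_snd)
  -- Since M is compact, one neighbourhood of 1 in K works for all m at once.
  obtain ⟨u, v, hu, hv, hu1, hvM, huv⟩ := generalized_tube_lemma (isCompact_singleton (x := (1 : K)))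
    (isCompact_univ (X := M)) ((isOpen_maximalIdeal_pow n).preimage hKM) (by
      rintro ⟨k, m⟩ ⟨rfl : k = 1, -⟩
      simp)
  have h1 : ∀ᶠ k : K in 𝓝 (1 : K), ∀ m : M, f (M.ρ (k : G) m) - f m ∈ maximalIdeal A ^ n := by
    filter_upwards [hu.mem_nhds (hu1 rfl)] with k hk m
    exact huv (show (k, m) ∈ u ×ˢ v from ⟨hk, hvM trivial⟩)
  have h2 : ∀ᶠ g in 𝓝 (1 : G), ∀ m : M, f (M.ρ g m) - f m ∈ maximalIdeal A ^ n := by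
    have := hKo.isOpenEmbedding_subtypeVal.map_nhds_eq (1 : K)
    rw [OneMemClass.coe_one] at this
    rw [← this, Filter.eventually_map]
    exact h1
  -- The contragredient action involves g⁻¹.
  have h3 : ∀ᶠ g in 𝓝 (1 : G), ∀ m : M, f (M.ρ g⁻¹ m) - f m ∈ maximalIdeal A ^ n := by
    have : Filter.Tendsto (fun g : G => g⁻¹) (𝓝 1) (𝓝 1) := by
      simpa using (continuous_inv (G := G)).tendsto 1
    exact this.eventually h2
  filter_upwards [h3] with g hg
  exact mem_pow_smul_top_of_forall_apply_mem μ hg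

end ContDual

/-- Van Dantzig's theorem. For a compact open W containing 1, the stabilizer of W is open by the
tube lemma, and it lies in W because 1 does; being open it is closed, hence compact. -/
theorem exists_isOpen_isCompact_subgroup (G : Type w) [Group G] [TopologicalSpace G]
    [IsTopologicalGroup G] [T2Space G] [LocallyCompactSpace G] [TotallyDisconnectedSpace G] :
    ∃ K : Subgroup G, IsOpen (K : Set G) ∧ IsCompact (K : Set G) := by
  obtain ⟨C, hC, hC1⟩ := exists_compact_mem_nhds (1 : G)
  obtain ⟨W, hW, hW1, hWC⟩ := loc_compact_Haus_tot_disc_of_zero_dim.mem_nhds_iff.1 hC1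
  have hWc : IsCompact W := hC.of_isClosed_subset hW.1 hWC
  let K : Subgroup G :=
    { carrier := {g | ∀ x ∈ W, g * x ∈ W ∧ g⁻¹ * x ∈ W}
      mul_mem' := fun {a b} ha hb x hx => by
        rw [mul_assoc, mul_inv_rev, mul_assoc]
        exact ⟨(ha _ (hb x hx).1).1, (hb _ (ha x hx).2).2⟩
      one_mem' := fun x hx => by simpa using hx
      inv_mem' := fun {a} ha x hx => by
        rw [inv_inv]
        exact (ha x hx).symm }
  have hKo : IsOpen (K : Set G) := by
    have h1 : IsOpen {p : G × G | p.1 * p.2 ∈ W ∧ p.1⁻¹ * p.2 ∈ W} :=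
      (hW.2.preimage continuous_mul).inter
        (hW.2.preimage (continuous_fst.inv.mul continuous_snd))
    obtain ⟨s, t, hs, -, hs1, ht, hst⟩ := generalized_tube_lemma
      (isCompact_singleton (x := (1 : G))) hWc h1 (by
        rintro ⟨g, x⟩ ⟨rfl : g = 1, hx⟩
        simpa using hx)
    exact K.isOpen_of_mem_nhds (g := 1) (Filter.mem_of_superset (hs.mem_nhds (hs1 rfl))
      fun g hg x hx => hst (show (g, x) ∈ s ×ˢ t from ⟨hg, ht hx⟩))
  refine ⟨K, hKo, hWc.of_isClosed_subset (K.isClosed_of_isOpen hKo) fun g hg => ?_⟩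
  simpa using (hg 1 hW1).1

/-! ### The action of A[[K]] on a profinite representation -/

section CompletedAction

variable {A : Type u} [CommRing A] {K : Type w} [Group K] [TopologicalSpace K]

/-- The reduction `A[K] → A[K/V]`. -/
abbrev groupAlgebraProj (A : Type u) [CommRing A] (V : OpenNormalSubgroup K) :
    MonoidAlgebra A K →+* MonoidAlgebra A (K ⧸ V.toSubgroup) :=
  MonoidAlgebra.mapDomainRingHom A (QuotientGroup.mk' V.toSubgroup)

/-- A lift of an element of `A[K/V]` to `A[K]`, supported on a set of representatives. -/
def groupAlgebraLift (V : OpenNormalSubgroup K) (a : MonoidAlgebra A (K ⧸ V.toSubgroup)) :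
    MonoidAlgebra A K :=
  MonoidAlgebra.mapDomain (fun q => Quotient.out q) a

theorem groupAlgebraProj_lift (V : OpenNormalSubgroup K)
    (a : MonoidAlgebra A (K ⧸ V.toSubgroup)) : groupAlgebraProj A V (groupAlgebraLift V a) = a := by
  induction a using MonoidAlgebra.induction_linear with
  | zero => simp [groupAlgebraLift]
  | add x y hx hy =>
    rw [groupAlgebraLift, MonoidAlgebra.mapDomain_add, map_add]
    exact congrArg₂ _ hx hy
  | single q a => simp [groupAlgebraLift]

theorem groupAlgebraProj_of_le {V V' : OpenNormalSubgroup K} (h : V ≤ V')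
    (l : CompletedGroupAlgebra A K) {x : MonoidAlgebra A K} (hx : groupAlgebraProj A V x = l.1 V) :
    groupAlgebraProj A V' x = l.1 V' := by
  rw [← l.2 V V' h, ← hx]
  exact ((toCompletedGroupAlgebra A K x).2 V V' h).symm

variable {M : Type v} [AddCommGroup M] [Module A M] (ρ : Representation A K M)

/-- A submodule `N` is fixed by `V` if it is stable under `K` and `V` acts trivially on `M/N`. -/
structure IsLevel (N : Submodule A M) (V : OpenNormalSubgroup K) : Prop where
  stable : ∀ (k : K) (m : M), m ∈ N → ρ k m ∈ N
  trivial : ∀ k ∈ V, ∀ m : M, ρ k m - m ∈ N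

variable {ρ}

namespace IsLevel

variable {N : Submodule A M} {V : OpenNormalSubgroup K}

theorem stable_groupAlgebra (h : IsLevel ρ N V) (x : MonoidAlgebra A K) {m : M} (hm : m ∈ N) :
    ρ.asAlgebraHom x m ∈ N := by
  induction x using MonoidAlgebra.induction_linear with
  | zero => simp
  | add x y hx hy => rw [map_add]; exact add_mem hx hy
  | single k a =>
    rw [Representation.asAlgebraHom_single]
    exact N.smul_mem a (h.stable k m hm)

/-- Two representatives of a coset of V differ by some v in V, which acts trivially modulo N. So
modulo N the action of A[K] factors through A[K/V]. -/
theorem sub_lift_mem (h : IsLevel ρ N V) (x : MonoidAlgebra A K) (m : M) :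
    ρ.asAlgebraHom x m - ρ.asAlgebraHom (groupAlgebraLift V (groupAlgebraProj A V x)) m ∈ N := by
  induction x using MonoidAlgebra.induction_linear with
  | zero => simp [groupAlgebraLift]
  | add x y hx hy =>
    rw [map_add, map_add, groupAlgebraLift, MonoidAlgebra.mapDomain_add, map_add,
      LinearMap.add_apply, LinearMap.add_apply, add_sub_add_comm]
    exact add_mem hx hy
  | single k a =>
    have : ∃ v ∈ V, Quotient.out (QuotientGroup.mk (s := V.toSubgroup) k) = k * v := by
      obtain ⟨v, hv⟩ := QuotientGroup.mk_out_eq_mul V.toSubgroup k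
      exact ⟨v, v.2, hv⟩
    obtain ⟨v, hv, hkv⟩ := this
    simp only [groupAlgebraLift, MonoidAlgebra.mapDomainRingHom_apply,
      MonoidAlgebra.mapDomain_single, QuotientGroup.mk'_apply, hkv,
      Representation.asAlgebraHom_single]
    rw [LinearMap.smul_apply, LinearMap.smul_apply, ← smul_sub, map_mul, Module.End.mul_apply,
      ← map_sub]
    refine N.smul_mem a (h.stable k _ ?_)
    rw [← neg_sub]
    exact N.neg_mem (h.trivial v hv m)

theorem sub_mem_of_proj_eq (h : IsLevel ρ N V) {x y : MonoidAlgebra A K}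
    (hxy : groupAlgebraProj A V x = groupAlgebraProj A V y) (m : M) :
    ρ.asAlgebraHom x m - ρ.asAlgebraHom y m ∈ N := by
  have := sub_mem (h.sub_lift_mem x m) (h.sub_lift_mem y m)
  rwa [hxy, sub_sub_sub_cancel_right] at this

theorem inf {N' : Submodule A M} {V' : OpenNormalSubgroup K} (h : IsLevel ρ N V)
    (h' : IsLevel ρ N' V') : IsLevel ρ (N ⊓ N') (V ⊓ V') where
  stable k m hm := ⟨h.stable k m hm.1, h'.stable k m hm.2⟩
  trivial k hk m := ⟨h.trivial k hk.1 m, h'.trivial k hk.2 m⟩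

end IsLevel

variable (ρ) in
theorem asAlgebraHom_groupAlgebraLift (V : OpenNormalSubgroup K)
    (a : MonoidAlgebra A (K ⧸ V.toSubgroup)) (m : M) :
    ρ.asAlgebraHom (groupAlgebraLift V a) m = a.coeff.sum fun q b => b • ρ (Quotient.out q) m := by
  induction a using MonoidAlgebra.induction_linear with
  | zero => simp [groupAlgebraLift]
  | add x y hx hy =>
    rw [groupAlgebraLift, MonoidAlgebra.mapDomain_add, map_add, LinearMap.add_apply,
      MonoidAlgebra.coeff_add, Finsupp.sum_add_index' (by simp) fun _ _ _ => add_smul _ _ _,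
      ← hx, ← hy]
    rfl
  | single q b => simp [groupAlgebraLift]

variable [TopologicalSpace M]

variable (ρ) in
/-- The open submodules fixed by an open normal subgroup form a basis of neighbourhoods of `0`. -/
def HasLevels : Prop := ∀ s ∈ 𝓝 (0 : M), ∃ (N : Submodule A M) (V : OpenNormalSubgroup K),
  IsOpen (N : Set M) ∧ IsLevel ρ N V ∧ (N : Set M) ⊆ s

theorem HasLevels.eq_of_forall_sub_mem [T2Space M] (h : HasLevels ρ) {y z : M}
    (hyz : ∀ (N : Submodule A M) (V : OpenNormalSubgroup K), IsOpen (N : Set M) → IsLevel ρ N V →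
      y - z ∈ N) : y = z := by
  by_contra hne
  obtain ⟨N, V, hN, hNV, hs⟩ := h {y - z}ᶜ
    (isOpen_compl_singleton.mem_nhds (Ne.symm (sub_ne_zero.2 hne)))
  exact hs (hyz N V hN hNV) rfl

variable [IsTopologicalAddGroup M]

/-- At each level (N, V) the component of l in A[K/V] prescribes a coset of N. These cosets are
closed and nonempty, and intersecting levels shows that they are directed. A common point exists
since M is compact. -/
theorem HasLevels.exists_action [CompactSpace M] (h : HasLevels ρ)
    (l : CompletedGroupAlgebra A K) (m : M) : ∃ y : M, ∀ (N : Submodule A M)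
      (V : OpenNormalSubgroup K), IsOpen (N : Set M) → IsLevel ρ N V →
      ∀ x : MonoidAlgebra A K, groupAlgebraProj A V x = l.1 V → ρ.asAlgebraHom x m - y ∈ N := by
  let ι := {p : Submodule A M × OpenNormalSubgroup K // IsOpen (p.1 : Set M) ∧ IsLevel ρ p.1 p.2}
  let C : ι → Set M := fun p =>
    {y | ρ.asAlgebraHom (groupAlgebraLift p.1.2 (l.1 p.1.2)) m - y ∈ p.1.1}
  have hne : Nonempty ι := by
    obtain ⟨N, V, hN, hNV, -⟩ := h Set.univ Filter.univ_mem
    exact ⟨⟨(N, V), hN, hNV⟩⟩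
  have hclosed : ∀ p, IsClosed (C p) := fun p =>
    (AddSubgroup.isClosed_of_isOpen p.1.1.toAddSubgroup p.2.1).preimage
      (continuous_const.sub continuous_id)
  obtain ⟨y, hy⟩ := IsCompact.nonempty_iInter_of_directed_nonempty_isCompact_isClosed C (by
      intro p q
      refine ⟨⟨(p.1.1 ⊓ q.1.1, p.1.2 ⊓ q.1.2), p.2.1.inter q.2.1, p.2.2.inf q.2.2⟩, ?_, ?_⟩
      · intro y hy
        have := p.2.2.sub_mem_of_proj_eq ((groupAlgebraProj_lift p.1.2 (l.1 p.1.2)).trans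
          (groupAlgebraProj_of_le (inf_le_left : p.1.2 ⊓ q.1.2 ≤ p.1.2) l
            (groupAlgebraProj_lift _ _)).symm) m
        have := add_mem this hy.1
        rwa [sub_add_sub_cancel] at this
      · intro y hy
        have := q.2.2.sub_mem_of_proj_eq ((groupAlgebraProj_lift q.1.2 (l.1 q.1.2)).trans
          (groupAlgebraProj_of_le (inf_le_right : p.1.2 ⊓ q.1.2 ≤ q.1.2) l
            (groupAlgebraProj_lift _ _)).symm) m
        have := add_mem this hy.2
        rwa [sub_add_sub_cancel] at this)
    (fun p => ⟨ρ.asAlgebraHom (groupAlgebraLift p.1.2 (l.1 p.1.2)) m, by simp [C]⟩)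
    (fun p => (hclosed p).isCompact) hclosed
  refine ⟨y, fun N V hN hNV x hx => ?_⟩
  have h1 := hNV.sub_mem_of_proj_eq (hx.trans (groupAlgebraProj_lift V (l.1 V)).symm) m
  have h2 := Set.mem_iInter.1 hy ⟨(N, V), hN, hNV⟩
  simpa using add_mem h1 h2

variable [CompactSpace M]

/-- The action of `A[[K]]`, as the limit of the actions on the quotients `M/N`. -/
def HasLevels.act (h : HasLevels ρ) (l : CompletedGroupAlgebra A K) (m : M) : M :=
  (h.exists_action l m).choose

theorem HasLevels.sub_act_mem (h : HasLevels ρ) {N : Submodule A M} {V : OpenNormalSubgroup K}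
    (hN : IsOpen (N : Set M)) (hNV : IsLevel ρ N V) {l : CompletedGroupAlgebra A K}
    {x : MonoidAlgebra A K} (hx : groupAlgebraProj A V x = l.1 V) (m : M) :
    ρ.asAlgebraHom x m - h.act l m ∈ N :=
  (h.exists_action l m).choose_spec N V hN hNV x hx

theorem HasLevels.act_mem (h : HasLevels ρ) {N : Submodule A M} {V : OpenNormalSubgroup K}
    (hN : IsOpen (N : Set M)) (hNV : IsLevel ρ N V) (l : CompletedGroupAlgebra A K) {m : M}
    (hm : m ∈ N) : h.act l m ∈ N := by
  have := h.sub_act_mem hN hNV (groupAlgebraProj_lift V (l.1 V)) m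
  simpa using sub_mem (hNV.stable_groupAlgebra (groupAlgebraLift V (l.1 V)) hm) this

theorem HasLevels.act_mem_of_coeff (h : HasLevels ρ) {N : Submodule A M}
    {V : OpenNormalSubgroup K} (hN : IsOpen (N : Set M)) (hNV : IsLevel ρ N V) {J : Ideal A}
    (hJ : ∀ a ∈ J, ∀ m : M, a • m ∈ N) {l : CompletedGroupAlgebra A K}
    (hl : ∀ q, (l.1 V).coeff q ∈ J) (m : M) : h.act l m ∈ N := by
  have h1 : ρ.asAlgebraHom (groupAlgebraLift V (l.1 V)) m ∈ N := by
    rw [asAlgebraHom_groupAlgebraLift]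
    exact Submodule.sum_mem _ fun q _ => hJ _ (hl q) _
  simpa using sub_mem h1 (h.sub_act_mem hN hNV (groupAlgebraProj_lift V (l.1 V)) m)

variable [T2Space M]

/-- M is Hausdorff, so a value of the action is pinned down by its classes modulo all levels. The
module axioms are verified in this way, with a convenient lift to A[K] at each level. -/
theorem HasLevels.act_eq (h : HasLevels ρ) {l : CompletedGroupAlgebra A K} {m y : M}
    (hy : ∀ (N : Submodule A M) (V : OpenNormalSubgroup K), IsOpen (N : Set M) → IsLevel ρ N V →
      ∃ x : MonoidAlgebra A K, groupAlgebraProj A V x = l.1 V ∧ ρ.asAlgebraHom x m - y ∈ N) :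
    h.act l m = y := by
  refine h.eq_of_forall_sub_mem fun N V hN hNV => ?_
  obtain ⟨x, hx, hxy⟩ := hy N V hN hNV
  simpa using sub_mem hxy (h.sub_act_mem hN hNV hx m)

theorem HasLevels.act_toCompletedGroupAlgebra (h : HasLevels ρ) (x : MonoidAlgebra A K) (m : M) :
    h.act (toCompletedGroupAlgebra A K x) m = ρ.asAlgebraHom x m :=
  h.act_eq fun _ _ _ _ => ⟨x, rfl, by simp⟩

theorem HasLevels.act_add (h : HasLevels ρ) (l : CompletedGroupAlgebra A K) (m m' : M) :
    h.act l (m + m') = h.act l m + h.act l m' :=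
  h.act_eq fun N V hN hNV => ⟨_, groupAlgebraProj_lift V (l.1 V), by
    rw [map_add, add_sub_add_comm]
    exact add_mem (h.sub_act_mem hN hNV (groupAlgebraProj_lift _ _) _)
      (h.sub_act_mem hN hNV (groupAlgebraProj_lift _ _) _)⟩

/-- The structure of module over the completed group algebra on a profinite representation. -/
abbrev HasLevels.module (h : HasLevels ρ) : Module (CompletedGroupAlgebra A K) M where
  smul := h.act
  one_smul m := h.act_eq fun _ _ _ _ => ⟨1, map_one _, by simp⟩
  mul_smul l l' m := h.act_eq fun N V hN hNV => by
    refine ⟨groupAlgebraLift V (l.1 V) * groupAlgebraLift V (l'.1 V), ?_, ?_⟩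
    · rw [map_mul, groupAlgebraProj_lift, groupAlgebraProj_lift]; rfl
    · have h1 := h.sub_act_mem hN hNV (groupAlgebraProj_lift V (l'.1 V)) m
      have h2 := h.sub_act_mem hN hNV (groupAlgebraProj_lift V (l.1 V)) (h.act l' m)
      have h3 := hNV.stable_groupAlgebra (groupAlgebraLift V (l.1 V)) h1
      rw [map_mul, Module.End.mul_apply]
      rw [map_sub] at h3
      have := add_mem h3 h2
      rwa [sub_add_sub_cancel] at this
  smul_zero l := h.act_eq fun N V hN hNV => ⟨_, groupAlgebraProj_lift V (l.1 V), by simp⟩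
  smul_add := h.act_add
  add_smul l l' m := h.act_eq fun N V hN hNV => by
    refine ⟨groupAlgebraLift V (l.1 V) + groupAlgebraLift V (l'.1 V), ?_, ?_⟩
    · rw [map_add, groupAlgebraProj_lift, groupAlgebraProj_lift]; rfl
    · rw [map_add, LinearMap.add_apply, add_sub_add_comm]
      exact add_mem (h.sub_act_mem hN hNV (groupAlgebraProj_lift _ _) _)
        (h.sub_act_mem hN hNV (groupAlgebraProj_lift _ _) _)
  zero_smul m := h.act_eq fun _ _ _ _ => ⟨0, map_zero _, by simp⟩

/-- The difference l m - l₀ m₀ equals (l - l₀) m + l₀ (m - m₀). The second term stays in N by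
stability, and the first does once the coefficients of l - l₀ in A[K/V] are small. -/
theorem HasLevels.continuous_act [TopologicalSpace A] [IsCompleteNoetherianLocal A]
    [ContinuousSMul A M] [IsTopologicalGroup K] [CompactSpace K]
    (h : HasLevels ρ) : Continuous fun p : CompletedGroupAlgebra A K × M => h.act p.1 p.2 := by
  refine continuous_iff_continuousAt.2 fun ⟨l₀, m₀⟩ => ?_
  rw [ContinuousAt, tendsto_sub_nhds_zero_iff.symm, Filter.tendsto_def]
  intro s hs
  obtain ⟨N, V, hN, hNV, hNs⟩ := h s hs
  -- Compactness of M yields a single n with 𝔪ⁿM ⊆ N.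
  obtain ⟨t, t', ht, -, ht0, ht', htt⟩ := generalized_tube_lemma
    (isCompact_singleton (x := (0 : A))) (isCompact_univ (X := M))
    (hN.preimage (continuous_smul : Continuous fun p : A × M => p.1 • p.2)) (by
      rintro ⟨a, m⟩ ⟨rfl : a = 0, -⟩
      simp)
  obtain ⟨n, hn⟩ := exists_pow_subset (ht.mem_nhds (ht0 rfl))
  -- With finitely many cosets, smallness of all the coefficients is an open condition on l.
  have : Finite (K ⧸ V.toSubgroup) := V.toSubgroup.quotient_finite_of_isOpen V.isOpen'
  have h1 : ∀ᶠ l in 𝓝 l₀, ∀ q, ((l - l₀).1 V).coeff q ∈ maximalIdeal A ^ n := by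
    rw [Filter.eventually_all]
    intro q
    have hd : Continuous fun (l : CompletedGroupAlgebra A K) (V : OpenNormalSubgroup K)
        (q : K ⧸ V.toSubgroup) => (l.1 V).coeff q := continuous_induced_dom
    have hc := continuous_pi_iff.1 (continuous_pi_iff.1 hd V) q
    have h0 : l₀ ∈ (fun l : CompletedGroupAlgebra A K => (l.1 V).coeff q - (l₀.1 V).coeff q) ⁻¹'
        ((maximalIdeal A ^ n : Ideal A) : Set A) := by simp
    exact ((isOpen_maximalIdeal_pow n).preimage (hc.sub continuous_const)).mem_nhds h0
  have h2 : ∀ᶠ m in 𝓝 m₀, m - m₀ ∈ N :=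
    (hN.preimage (continuous_id.sub continuous_const)).mem_nhds (by simp)
  rw [nhds_prod_eq]
  filter_upwards [h1.prod_mk h2] with ⟨l, m⟩ ⟨hl, hm⟩
  refine hNs ?_
  let := h.module
  have e : l • m - l₀ • m₀ = (l - l₀) • m + l₀ • (m - m₀) := by
    rw [sub_smul, smul_sub, sub_add_sub_cancel]
  change l • m - l₀ • m₀ ∈ N
  rw [e]
  exact add_mem (h.act_mem_of_coeff hN hNV (fun a ha m => htt
    (show (a, m) ∈ t ×ˢ t' from ⟨hn ha, ht' trivial⟩)) hl m) (h.act_mem hN hNV l₀ hm)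

end CompletedAction

theorem PointwiseDual.map_sub' {A : Type u} [CommRing A] {U : Type v} [AddCommGroup U] [Module A U]
    (f : PointwiseDual A U) (x y : U) : f (x - y) = f x - f y :=
  map_sub (show Module.Dual A U from f) x y

/-! ### Stable open submodules of the pointwise dual -/

section PointwiseDualLevels

variable {A : Type u} [CommRing A] [TopologicalSpace A] [IsCompleteNoetherianLocal A]
  {U : Type v} [AddCommGroup U] [Module A U]

namespace PointwiseDual

theorem exists_finset_subset_of_mem_nhds_zero {s : Set (PointwiseDual A U)} (hs : s ∈ 𝓝 0) :
    ∃ (S : Finset U) (n : ℕ), {f : PointwiseDual A U | ∀ x ∈ S, f x ∈ maximalIdeal A ^ n} ⊆ s := by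
  rw [nhds_induced, Filter.mem_comap] at hs
  obtain ⟨t, ht, hts⟩ := hs
  rw [nhds_pi, Filter.mem_pi] at ht
  obtain ⟨S, hS, t', ht', htt⟩ := ht
  choose n hn using fun x => exists_pow_subset (ht' x)
  refine ⟨hS.toFinset, hS.toFinset.sup n, fun f hf => hts (htt fun x hx => hn x ?_)⟩
  exact Ideal.pow_le_pow_right (Finset.le_sup (hS.mem_toFinset.2 hx)) (hf x (hS.mem_toFinset.2 hx))

theorem apply_mem_pow (f : PointwiseDual A U) {n : ℕ} {x : U}
    (hx : x ∈ maximalIdeal A ^ n • (⊤ : Submodule A U)) : f x ∈ maximalIdeal A ^ n := by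
  have h := map_mem_ideal_smul_top (show Module.Dual A U from f) hx
  rw [smul_eq_mul, Ideal.mul_top] at h
  exact h

theorem apply_mem_pow_iff (f : PointwiseDual A U) {n : ℕ} {x y : U}
    (hx : x - y ∈ maximalIdeal A ^ n • (⊤ : Submodule A U)) :
    f x ∈ maximalIdeal A ^ n ↔ f y ∈ maximalIdeal A ^ n := by
  have := apply_mem_pow f hx
  rw [map_sub'] at this
  exact ⟨fun h => by simpa using sub_mem h this, fun h => by simpa using add_mem this h⟩

theorem isOpen_setOf_forall_mem (T : Finset U) (n : ℕ) :
    IsOpen {f : PointwiseDual A U | ∀ x ∈ T, f x ∈ maximalIdeal A ^ n} := by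
  have : {f : PointwiseDual A U | ∀ x ∈ T, f x ∈ maximalIdeal A ^ n} =
      ⋂ x ∈ T, {f : PointwiseDual A U | f x ∈ maximalIdeal A ^ n} := by ext; simp
  rw [this]
  exact isOpen_biInter_finset fun x _ => (isOpen_maximalIdeal_pow n).preimage (continuous_eval x)

/-- The contragredient of a continuous representation of a profinite group has a basis of
neighbourhoods of zero consisting of stable open submodules. -/
theorem hasLevels {K : Type w} [Group K] [TopologicalSpace K] [IsTopologicalGroup K]
    [CompactSpace K] [TotallyDisconnectedSpace K] (ρ : Representation A K U)
    (hρ : ∀ (x : U) (n : ℕ),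
      ∀ᶠ k in 𝓝 (1 : K), ρ k x - x ∈ maximalIdeal A ^ n • (⊤ : Submodule A U))
    (σ : Representation A K (PointwiseDual A U)) (hσ : ∀ k f x, σ k f x = f (ρ k⁻¹ x)) :
    HasLevels σ := by
  classical
  intro s hs
  obtain ⟨S, n, hS⟩ := exists_finset_subset_of_mem_nhds_zero hs
  -- As K is compact, each orbit takes finitely many values modulo 𝔪ⁿU; T x is a finite set of
  -- representatives.
  have hfin : ∀ x : U, ∃ T : Finset U, ∀ k : K, ∃ t ∈ T,
      ρ k x - t ∈ maximalIdeal A ^ n • (⊤ : Submodule A U) := by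
    intro x
    obtain ⟨t, -, ht⟩ := isCompact_univ.elim_nhds_subcover
      (fun k : K => {k' | ρ k' x - ρ k x ∈ maximalIdeal A ^ n • (⊤ : Submodule A U)}) fun k _ => by
        have h : Filter.Tendsto (fun k' : K => k⁻¹ * k') (𝓝 k) (𝓝 1) := by
          have : Continuous fun k' : K => k⁻¹ * k' := by fun_prop
          simpa using this.tendsto k
        filter_upwards [h (hρ x n)] with k' hk'
        have := map_mem_ideal_smul_top (ρ k) hk'
        rwa [map_sub, ← Module.End.mul_apply, ← map_mul, mul_inv_cancel_left] at this
    refine ⟨t.image fun k => ρ k x, fun k => ?_⟩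
    obtain ⟨k₀, hk₀, hk⟩ := Set.mem_iUnion₂.1 (ht (Set.mem_univ k))
    exact ⟨_, Finset.mem_image_of_mem _ hk₀, hk⟩
  choose T hT using hfin
  -- Requiring smallness on whole orbits makes N stable. It remains open because it suffices to test
  -- f on the finite set `S.biUnion T`.
  let N : Submodule A (PointwiseDual A U) :=
    { carrier := {f | ∀ x ∈ S, ∀ k, f (ρ k x) ∈ maximalIdeal A ^ n}
      add_mem' := fun hf hg x hx k => add_mem (hf x hx k) (hg x hx k)
      zero_mem' := fun _ _ _ => zero_mem _
      smul_mem' := fun a f hf x hx k => Ideal.mul_mem_left _ a (hf x hx k) }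
  have hev : ∀ᶠ k in 𝓝 (1 : K), ∀ t ∈ S.biUnion T,
      ρ k⁻¹ t - t ∈ maximalIdeal A ^ n • (⊤ : Submodule A U) := by
    rw [Filter.eventually_all_finset]
    intro t _
    have h : Filter.Tendsto (fun k : K => k⁻¹) (𝓝 1) (𝓝 1) := by
      simpa using (continuous_inv (G := K)).tendsto 1
    exact h.eventually (hρ t n)
  obtain ⟨W, hW, hWo, hW1⟩ := eventually_nhds_iff.1 hev
  obtain ⟨V, hV⟩ := ProfiniteGrp.exist_openNormalSubgroup_sub_open_nhds_of_one hWo hW1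
  refine ⟨N, V, ?_, ⟨fun k f hf x hx k' => ?_, fun v hv f x hx k => ?_⟩, fun f hf => hS fun x hx => ?_⟩
  · refine N.toAddSubgroup.isOpen_of_mem_nhds (g := 0) (Filter.mem_of_superset
      ((isOpen_setOf_forall_mem (S.biUnion T) n).mem_nhds fun _ _ => zero_mem _) ?_)
    intro f hf x hx k
    obtain ⟨t, ht, hkt⟩ := hT x k
    exact (apply_mem_pow_iff f hkt).2 (hf t (Finset.mem_biUnion.2 ⟨x, hx, ht⟩))
  · rw [hσ, ← Module.End.mul_apply, ← map_mul]
    exact hf x hx _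
  · obtain ⟨t, ht, hkt⟩ := hT x k
    change σ v f (ρ k x) - f (ρ k x) ∈ _
    rw [hσ, ← map_sub']
    refine apply_mem_pow f ?_
    have h1 := hW v (hV hv) t (Finset.mem_biUnion.2 ⟨x, hx, ht⟩)
    have h2 := map_mem_ideal_smul_top (ρ v⁻¹) hkt
    have := sub_mem (add_mem h2 h1) hkt
    rw [map_sub, sub_add_sub_cancel, sub_sub_sub_cancel_right] at this
    exact this
  · simpa using hf x hx 1

end PointwiseDual

/-- The pointwise dual of a module isomorphic to a module of null families is a product. -/
def pointwiseDualPiEquiv {U : Type u} [AddCommGroup U] [Module A U] {I : Type u}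
    (e : NullFamily A I ≃ₗ[A] U) : (I → A) ≃L[A] PointwiseDual A U :=
  NullFamily.pointwiseDualEquiv.trans
    (ContinuousLinearEquiv.equivOfInverse (PointwiseDual.map (e.symm : U →ₗ[A] NullFamily A I))
      (PointwiseDual.map (e : NullFamily A I →ₗ[A] U))
      (fun f => PointwiseDual.ext fun x => by simp)
      (fun f => PointwiseDual.ext fun x => by simp))

theorem pointwiseDualPiEquiv_apply {U : Type u} [AddCommGroup U] [Module A U] {I : Type u}
    (e : NullFamily A I ≃ₗ[A] U) (g : I → A) (c : NullFamily A I) :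
    pointwiseDualPiEquiv e g (e c) = NullFamily.pairing c g :=
  (congrArg (fun c => NullFamily.pairing c g) (e.symm_apply_apply c) :)

end PointwiseDualLevels

/-! ### The pointwise dual is an augmented representation -/

section DualProAug

variable {A : Type u} [CommRing A] [TopologicalSpace A] [IsCompleteNoetherianLocal A]
  {G : Type w} [Group G] [TopologicalSpace G] [IsTopologicalGroup G] [T2Space G]
  [LocallyCompactSpace G] [TotallyDisconnectedSpace G]

/-- Any compact open K serves. The levels supply both the linear topology and the A[[K]]-module
structure, while the coordinates A^I supply profiniteness and topological freeness. -/
theorem proAugFl_dual (π : Rep.{u} A G) (hπ : contFl A G π) :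
    proAugFl A G ((dualFunctor A G).obj (.op π)) := by
  obtain ⟨I, ⟨e⟩⟩ := IsOrthonormalizable.exists_equiv A π hπ.2
  let μ := pointwiseDualPiEquiv e
  have : CompactSpace (PointwiseDual A π) := μ.toHomeomorph.compactSpace
  have : T2Space (PointwiseDual A π) := μ.toHomeomorph.t2Space
  have : TotallyDisconnectedSpace (PointwiseDual A π) := μ.toHomeomorph.totallyDisconnectedSpace
  obtain ⟨K, hKo, hKc⟩ := exists_isOpen_isCompact_subgroup G
  have : CompactSpace K := isCompact_iff_compactSpace.1 hKc
  have hπ' := ((isAdicallyContinuous_iff π).1 hπ.1).2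
  have hL : HasLevels ((contragredient A G π).toRepresentation.comp K.subtype) :=
    PointwiseDual.hasLevels (π.ρ.comp K.subtype) (fun x n => by
      have : Filter.Tendsto (Subtype.val : K → G) (𝓝 1) (𝓝 1) :=
        continuous_subtype_val.tendsto (1 : K)
      exact this.eventually (hπ' x n)) _ fun k f x => rfl
  have hlin : IsLinearTopology A (PointwiseDual A π) := by
    refine IsLinearTopology.mk_of_hasBasis' A (ι := Submodule A (PointwiseDual A π))
      (S := Submodule A (PointwiseDual A π))
      (p := fun N => IsOpen (N : Set (PointwiseDual A π))) (s := id) ⟨fun s => ⟨fun hs => ?_, ?_⟩⟩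
      fun N a m hm => N.smul_mem a hm
    · obtain ⟨N, V, hN, -, hNs⟩ := hL s hs
      exact ⟨N, hN, hNs⟩
    · rintro ⟨N, hN, hNs⟩
      exact Filter.mem_of_superset (hN.mem_nhds (zero_mem N)) hNs
  exact ⟨⟨⟨‹_›, ‹_›, ‹_›, hlin⟩, K, hKo, hKc, hL.module, hL.act_toCompletedGroupAlgebra,
    hL.continuous_act⟩, I, ⟨μ.symm⟩⟩

end DualProAug

/-- A `G`-equivariant isomorphism of topological modules is an isomorphism of topological
representations. -/
def TopRep.isoOfEquiv {A : Type u} [CommRing A] [TopologicalSpace A] {G : Type w} [Group G]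
    {M N : TopRep.{v} A G} (e : M ≃L[A] N) (he : ∀ g m, e (M.ρ g m) = N.ρ g (e m)) : M ≅ N where
  hom := TopRep.ofHom (ρ := M.ρ) (σ := N.ρ)
    { (e : M →L[A] N) with isIntertwining' := fun g => ContinuousLinearMap.ext fun m => he g m }
  inv := TopRep.ofHom (ρ := N.ρ) (σ := M.ρ)
    { (e.symm : N →L[A] M) with
      isIntertwining' := fun g => ContinuousLinearMap.ext fun n =>
        e.injective ((e.apply_symm_apply _).trans
          (((he g _).trans (congrArg (N.ρ g) (e.apply_symm_apply n))).symm)) }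
  hom_inv_id := TopRep.hom_ext (ContIntertwiningMap.ext (ContinuousLinearMap.ext e.symm_apply_apply))
  inv_hom_id := TopRep.hom_ext (ContIntertwiningMap.ext (ContinuousLinearMap.ext e.apply_symm_apply))

/-- A bijective continuous linear map from a compact module to a Hausdorff module is an isomorphism
of topological modules. -/
def ContinuousLinearEquiv.ofBijectiveCompactToT2 {A M N : Type*} [CommRing A] [AddCommGroup M]
    [Module A M] [TopologicalSpace M] [AddCommGroup N] [Module A N] [TopologicalSpace N]
    [CompactSpace M] [T2Space N] (f : M →L[A] N) (hf : Function.Bijective f) : M ≃L[A] N :=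
  { LinearEquiv.ofBijective f.toLinearMap hf with
    continuous_toFun := f.continuous
    continuous_invFun := Continuous.continuous_symm_of_equiv_compact_to_t2
      (f := (LinearEquiv.ofBijective f.toLinearMap hf).toEquiv) f.continuous }

theorem TopRep.isIso_of_bijective {A : Type u} [CommRing A] [TopologicalSpace A] {G : Type w}
    [Group G] {M N : TopRep.{v} A G} [CompactSpace M] [T2Space N] (f : M ⟶ N)
    (hf : Function.Bijective f.hom) : IsIso f :=
  (TopRep.isoOfEquiv (ContinuousLinearEquiv.ofBijectiveCompactToT2
    f.hom.toContinuousLinearMap hf) fun g m => TopRep.hom_comm_apply f g m).isIso_hom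

/-! ### Biduality and the anti-equivalence -/

section Duality

variable {A : Type u} [CommRing A] [TopologicalSpace A] [IsCompleteNoetherianLocal A]
  {G : Type w} [Group G] [TopologicalSpace G]

/-- In coordinates this is the bijection between c₀(I, A) and the continuous forms on A^I. Morphisms
of `Rep` carry no topology, so bijectivity is enough. -/
theorem isIso_evalRep (π : Rep.{u} A G) (hπ : contFl A G π) : IsIso (evalRep A G π) := by
  classical
  obtain ⟨I, ⟨e⟩⟩ := IsOrthonormalizable.exists_equiv A π hπ.2
  let μ := pointwiseDualPiEquiv e
  rw [ConcreteCategory.isIso_iff_bijective]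
  refine ⟨(injective_iff_map_eq_zero (evalRep A G π).hom).2 fun x hx => ?_, fun F => ?_⟩
  · obtain ⟨c, rfl⟩ := e.surjective x
    have h : ∀ g, NullFamily.pairing c g = 0 := fun g => by
      rw [← pointwiseDualPiEquiv_apply e]
      exact congrArg (fun F : PointwiseDual A π →L[A] A => F (μ g)) hx
    have : c = 0 := by
      ext i
      simpa using h (Pi.single i 1)
    rw [this, map_zero]
  · let F' : PointwiseDual A π →L[A] A := F
    let c := NullFamily.contDualEquiv.symm (F'.comp (μ : (I → A) →L[A] PointwiseDual A π))
    have hc : ∀ g, NullFamily.pairing c g = F' (μ g) := fun g => by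
      rw [← NullFamily.contDualEquiv_apply, LinearEquiv.apply_symm_apply]
      rfl
    refine ⟨e c, ContinuousLinearMap.ext fun f : PointwiseDual A π => ?_⟩
    obtain ⟨g, rfl⟩ := μ.surjective f
    exact (pointwiseDualPiEquiv_apply e g c).trans (hc g)

/-- In coordinates this is the bijection between A^I and the linear forms on c₀(I, A). It is a
homeomorphism since M is compact and the bidual Hausdorff. -/
theorem isIso_evalTopRep (M : TopRep.{u} A G) (hM : proAugFl A G M) :
    IsIso (evalTopRep A G M) := by
  obtain ⟨⟨hprof, -⟩, I, ⟨ν⟩⟩ := hM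
  have := hprof.compactSpace
  have : T2Space ((dualFunctor A G).obj (.op ((contDualFunctor A G).obj (.op M)))) :=
    inferInstanceAs (T2Space (PointwiseDual A (M →L[A] A)))
  let e := contDualNullFamilyEquiv ν
  refine TopRep.isIso_of_bijective _
    ⟨(injective_iff_map_eq_zero (evalTopRep A G M).hom).2 fun m hm => ?_, fun F => ?_⟩
  · have h : ∀ c, NullFamily.pairing c (ν m) = 0 := fun c => by
      rw [← e.apply_symm_apply c, pairing_contDualNullFamilyEquiv]
      exact congrArg (fun F : PointwiseDual A (M →L[A] A) => F (e.symm c)) hm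
    refine ν.map_eq_zero_iff.1 (funext fun i => ?_)
    simpa using h (NullFamily.single i 1)
  · let F' : Module.Dual A (M →L[A] A) := F
    let g : I → A := fun i => F' (e.symm (NullFamily.single i 1))
    refine ⟨ν.symm g, PointwiseDual.ext (U := M →L[A] A) fun f => ?_⟩
    have h := NullFamily.eq_pairing (F' ∘ₗ (e.symm : NullFamily A I →ₗ[A] (M →L[A] A))) (e f)
    have h2 : F' f = NullFamily.pairing (e f) g := by
      exact (congrArg F' (e.symm_apply_apply f).symm).trans h
    have h3 := pairing_contDualNullFamilyEquiv ν f (ν.symm g)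
    rw [ν.apply_symm_apply] at h3
    exact h3.symm.trans h2.symm

variable
  (hD : ∀ π : Rep.{u} A G, contFl A G π → proAugFl A G ((dualFunctor A G).obj (.op π)))
  (hE : ∀ M : TopRep.{u} A G, proAugFl A G M → contFl A G ((contDualFunctor A G).obj (.op M)))

/-- The evaluation maps `π → π^∨^∨` form a natural isomorphism. -/
def evalRepNatIso : 𝟭 (contFl.{u} A G).FullSubcategory ≅ (dualFl A G hD).rightOp ⋙ contDualFl A G hE :=
  NatIso.ofComponents (fun X =>
    (contFl A G).isoMk (@asIso _ _ _ _ (evalRep A G X.obj) (isIso_evalRep X.obj X.property)))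
    fun {X Y} f => by
      apply InducedCategory.Hom.ext
      refine Rep.hom_ext (Representation.IntertwiningMap.ext (LinearMap.ext fun x => ?_))
      rfl

/-- The evaluation maps `M → M^∨^∨` form a natural isomorphism. -/
def evalTopRepNatIso :
    𝟭 (proAugFl.{u} A G).FullSubcategory ≅ (contDualFl A G hE).rightOp ⋙ dualFl A G hD :=
  NatIso.ofComponents (fun X =>
    (proAugFl A G).isoMk
      (@asIso _ _ _ _ (evalTopRep A G X.obj) (isIso_evalTopRep X.obj X.property)))
    fun {X Y} f => by
      apply InducedCategory.Hom.ext
      refine TopRep.hom_ext (ContIntertwiningMap.ext (ContinuousLinearMap.ext fun x => ?_))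
      rfl

theorem isEquivalence_dualFl
    (hE : ∀ M : TopRep.{u} A G, proAugFl A G M → contFl A G ((contDualFunctor A G).obj (.op M))) :
    (dualFl A G hD).IsEquivalence :=
  .mk' (contDualFl A G hE).rightOp
    (NatIso.ofComponents (fun X => ((evalRepNatIso hD hE).app X.unop).symm.op) fun f =>
      Quiver.Hom.unop_inj ((evalRepNatIso hD hE).inv.naturality f.unop).symm)
    (evalTopRepNatIso hD hE).symm

theorem isEquivalence_contDualFl
    (hD : ∀ π : Rep.{u} A G, contFl A G π → proAugFl A G ((dualFunctor A G).obj (.op π))) :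
    (contDualFl A G hE).IsEquivalence :=
  .mk' (dualFl A G hD).rightOp
    (NatIso.ofComponents (fun X => ((evalTopRepNatIso hD hE).app X.unop).symm.op) fun f =>
      Quiver.Hom.unop_inj ((evalTopRepNatIso hD hE).inv.naturality f.unop).symm)
    (evalRepNatIso hD hE).symm

end Duality

/-! ### Base change of null families -/

section AdicBaseChange

variable {A : Type u} [CommRing A] [TopologicalSpace A] [IsCompleteNoetherianLocal A]
  (A' : Type u) [CommRing A'] [TopologicalSpace A'] [IsCompleteNoetherianLocal A']
  [Algebra A A'] [IsLocalHom (algebraMap A A')]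

/-- Locality of A → A' sends 𝔪ⁿ into 𝔪'ⁿ, so 𝔪ⁿU dies after tensoring with A'/𝔪'ⁿ. -/
theorem tmul_eq_zero_of_mem_pow_smul_top {U : Type v} [AddCommGroup U] [Module A U] {n : ℕ}
    (b : A' ⧸ maximalIdeal A' ^ n) {x : U}
    (hx : x ∈ maximalIdeal A ^ n • (⊤ : Submodule A U)) : b ⊗ₜ[A] x = 0 := by
  refine Submodule.smul_induction_on hx (fun a ha y _ => ?_) fun x y hx hy => ?_
  · rw [← TensorProduct.smul_tmul]
    have : a • b = 0 := by
      obtain ⟨b, rfl⟩ := Ideal.Quotient.mk_surjective b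
      have h := Ideal.mul_mem_right b _ (map_maximalIdeal_pow_le (A' := A') ha)
      rw [← Algebra.smul_def] at h
      exact Ideal.Quotient.eq_zero_iff_mem.2 h
    rw [this, zero_tmul]
  · rw [tmul_add, hx, hy, add_zero]

namespace NullFamily

variable {I : Type v}

/-- The map `c₀(I, A) → (A'/𝔪'ⁿ)^(I)`. -/
def reduceBaseChange (n : ℕ) : NullFamily A I →ₗ[A] (I →₀ A' ⧸ maximalIdeal A' ^ n) where
  toFun c := Finsupp.ofSupportFinite (fun i => algebraMap A (A' ⧸ maximalIdeal A' ^ n) (c.1 i))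
    ((c.2 n).subset fun i hi h =>
      hi (Ideal.Quotient.eq_zero_iff_mem.2 (map_maximalIdeal_pow_le (A' := A') h)))
  map_add' c d := by ext i; exact map_add (algebraMap A (A' ⧸ maximalIdeal A' ^ n)) _ _
  map_smul' a c := by
    ext i
    exact (map_mul (algebraMap A (A' ⧸ maximalIdeal A' ^ n)) _ _).trans (Algebra.smul_def _ _).symm

theorem reduceBaseChange_single (n : ℕ) (i : I) :
    reduceBaseChange A' n (single i (1 : A)) = Finsupp.single i 1 := by
  classical
  ext j
  change algebraMap A (A' ⧸ maximalIdeal A' ^ n) ((single i (1 : A)).1 j) = _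
  rw [coe_single, Pi.single_apply, Finsupp.single_apply]
  simp only [eq_comm (a := i)]
  split_ifs <;> simp

/-- The coordinates on `A'/𝔪'ⁿ ⊗ c₀(I, A)`. -/
def tensorCoord (n : ℕ) :
    (A' ⧸ maximalIdeal A' ^ n) ⊗[A] NullFamily A I →ₗ[A' ⧸ maximalIdeal A' ^ n]
      (I →₀ A' ⧸ maximalIdeal A' ^ n) :=
  (reduceBaseChange A' n).liftBaseChange _

variable (A) in
/-- The combinations of the standard basis of `A'/𝔪'ⁿ ⊗ c₀(I, A)`. -/
def tensorCombination (n : ℕ) : (I →₀ A' ⧸ maximalIdeal A' ^ n) →ₗ[A' ⧸ maximalIdeal A' ^ n]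
    (A' ⧸ maximalIdeal A' ^ n) ⊗[A] NullFamily A I :=
  Finsupp.linearCombination _ fun i => 1 ⊗ₜ single i 1

variable {A'}

theorem tensorCoord_combination (n : ℕ) (y : I →₀ A' ⧸ maximalIdeal A' ^ n) :
    tensorCoord A' n (tensorCombination A A' n y) = y := by
  induction y using Finsupp.induction_linear with
  | zero => simp
  | add x y hx hy => rw [map_add, map_add, hx, hy]
  | single i b =>
    rw [tensorCombination, Finsupp.linearCombination_single, map_smul, tensorCoord,
      LinearMap.liftBaseChange_tmul, reduceBaseChange_single]
    simp

/-- A null family is a finite one plus an element of 𝔪ⁿ c₀(I, A), and the latter vanishes in the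
tensor product. -/
theorem tensorCombination_coord (n : ℕ) (x : (A' ⧸ maximalIdeal A' ^ n) ⊗[A] NullFamily A I) :
    tensorCombination A A' n (tensorCoord A' n x) = x := by
  induction x using TensorProduct.induction_on with
  | zero => simp
  | add x y hx hy => rw [map_add, map_add, hx, hy]
  | tmul b c =>
    rw [tensorCoord, LinearMap.liftBaseChange_tmul, map_smul, tensorCombination,
      Finsupp.linearCombination_apply, Finsupp.sum_of_support_subset (s := supp c n)]
    · have h : c = ∑ i ∈ supp c n, single i (c.1 i) + (c - ∑ i ∈ supp c n, single i (c.1 i)) := by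
        abel
      have h0 := mem_pow_smul_top.2
        (sub_sum_single_apply_mem (c := c) (n := n) (s := supp c n) fun i hi => apply_mem hi)
      conv_rhs => rw [h, tmul_add, tmul_eq_zero_of_mem_pow_smul_top A' b h0, add_zero, tmul_sum]
      rw [Finset.smul_sum]
      refine Finset.sum_congr rfl fun i _ => ?_
      rw [single_eq_smul i (c.1 i), ← TensorProduct.smul_tmul, TensorProduct.smul_tmul',
        TensorProduct.smul_tmul', smul_eq_mul, smul_eq_mul, mul_one, mul_comm, Algebra.smul_def]
      rfl
    · intro i hi
      by_contra h
      exact Finsupp.mem_support_iff.1 hi (Ideal.Quotient.eq_zero_iff_mem.2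
        (map_maximalIdeal_pow_le (A' := A') (apply_mem h)))
    · simp

theorem tensorCombination_reduce {n : ℕ} (c : NullFamily A' I) {s : Finset I}
    (hs : ∀ i ∉ s, c.1 i ∈ maximalIdeal A' ^ n) :
    tensorCombination A A' n (reduce n c) = ∑ i ∈ s, Ideal.Quotient.mk _ (c.1 i) ⊗ₜ single i 1 := by
  rw [tensorCombination, Finsupp.linearCombination_apply, Finsupp.sum_of_support_subset (s := s)]
  · refine Finset.sum_congr rfl fun i _ => ?_
    rw [TensorProduct.smul_tmul', smul_eq_mul, mul_one]
    rfl
  · intro i hi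
    by_contra h
    exact Finsupp.mem_support_iff.1 hi (Ideal.Quotient.eq_zero_iff_mem.2 (hs i h))
  · simp

variable (A') in
variable (A I) in
/-- The map `c₀(I, A') → c₀(I, A) ⊗̂ A'`. -/
def toAdicBaseChange : NullFamily A' I →ₗ[A'] adicBaseChange A A' (NullFamily A I) where
  toFun c := ⟨fun n => tensorCombination A A' n (reduce n c), fun m n h => by
    beta_reduce
    rw [tensorCombination_reduce c (s := supp c n) fun i hi => apply_mem hi,
      tensorCombination_reduce c (s := supp c n) fun i hi =>
        Ideal.pow_le_pow_right h (apply_mem hi), map_sum]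
    rfl⟩
  map_add' c d := Subtype.ext <| funext fun n => by
    simp only [map_add]; rfl
  map_smul' a c := Subtype.ext <| funext fun n => by
    simp only [map_smul]
    exact LinearMap.map_smul_of_tower _ a _

theorem toAdicBaseChange_apply (c : NullFamily A' I) (n : ℕ) :
    (toAdicBaseChange A A' I c).1 n = tensorCombination A A' n (reduce n c) := rfl

theorem mem_pow_smul_top_of_toAdicBaseChange_apply {c : NullFamily A' I} {n : ℕ}
    (h : (toAdicBaseChange A A' I c).1 n = 0) :
    c ∈ maximalIdeal A' ^ n • (⊤ : Submodule A' (NullFamily A' I)) := by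
  rw [← ker_reduce, LinearMap.mem_ker, ← tensorCoord_combination (A := A) n (reduce n c)]
  rw [toAdicBaseChange_apply] at h
  rw [h, map_zero]

/-- At level n this is the isomorphism (A'/𝔪'ⁿ)^(I) ≅ A'/𝔪'ⁿ ⊗ c₀(I, A). Lifts of the components of
a compatible family form a Cauchy sequence, so completeness of c₀(I, A') gives the bijection in the
limit. -/
theorem toAdicBaseChange_bijective : Function.Bijective (toAdicBaseChange A A' I) := by
  refine ⟨(injective_iff_map_eq_zero _).2 fun c hc => ?_, fun x => ?_⟩
  · refine IsHausdorff.haus (I := maximalIdeal A') inferInstance c fun n => SModEq.zero.2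
      (mem_pow_smul_top_of_toAdicBaseChange_apply (A := A) ?_)
    rw [hc]
    rfl
  · choose d hd using fun n => reduce_surjective (A := A') (I := I) n (tensorCoord A' n (x.1 n))
    have hd' : ∀ n, (toAdicBaseChange A A' I (d n)).1 n = x.1 n := fun n => by
      rw [toAdicBaseChange_apply, hd, tensorCombination_coord]
    obtain ⟨l, hl⟩ := IsPrecomplete.prec (I := maximalIdeal A') (M := NullFamily A' I) inferInstance
      (f := d) fun {m n} hmn => by
        refine SModEq.sub_mem.2 (mem_pow_smul_top_of_toAdicBaseChange_apply (A := A) ?_)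
        rw [map_sub]
        change (toAdicBaseChange A A' I (d m)).1 m - (toAdicBaseChange A A' I (d n)).1 m = 0
        rw [hd', ← (toAdicBaseChange A A' I (d n)).2 m n hmn, hd', x.2 m n hmn, sub_self]
    refine ⟨l, Subtype.ext (funext fun n => ?_)⟩
    rw [← hd' n, toAdicBaseChange_apply, toAdicBaseChange_apply]
    refine congrArg _ (sub_eq_zero.1 ?_)
    rw [← map_sub, ← LinearMap.mem_ker, ker_reduce, ← neg_sub]
    exact neg_mem (SModEq.sub_mem.1 (hl n))

end NullFamily

/-- The completed tensor products of isomorphic modules are isomorphic. -/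
def adicBaseChangeCongr {A : Type u} [CommRing A] (A' : Type u) [CommRing A'] [IsLocalRing A']
    [Algebra A A'] {U U' : Type v} [AddCommGroup U] [Module A U] [AddCommGroup U'] [Module A U']
    (e : U ≃ₗ[A] U') : adicBaseChange A A' U ≃ₗ[A'] adicBaseChange A A' U' :=
  LinearEquiv.ofLinearMap (adicBaseChangeMap A' (e : U →ₗ[A] U'))
    (adicBaseChangeMap A' (e.symm : U' →ₗ[A] U))
    (by rw [← adicBaseChangeMap_comp, LinearEquiv.comp_symm, adicBaseChangeMap_id])
    (by rw [← adicBaseChangeMap_comp, LinearEquiv.symm_comp, adicBaseChangeMap_id])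

variable {I : Type u} {U : Type u} [AddCommGroup U] [Module A U]

theorem adicBaseChangeCongr_symm_apply {A : Type u} [CommRing A] {A' : Type u} [CommRing A']
    [IsLocalRing A'] [Algebra A A'] {U U' : Type v} [AddCommGroup U] [Module A U] [AddCommGroup U']
    [Module A U'] (e : U ≃ₗ[A] U') (x : adicBaseChange A A' U') (n : ℕ) :
    ((adicBaseChangeCongr A' e).symm x).1 n = quotTensorMap le_rfl (e.symm : U' →ₗ[A] U) (x.1 n) :=
  rfl

/-- Base change of an isomorphism with a module of null families. -/
def adicBaseChangeEquiv (e : NullFamily A I ≃ₗ[A] U) :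
    NullFamily A' I ≃ₗ[A'] adicBaseChange A A' U :=
  (LinearEquiv.ofBijective _ NullFamily.toAdicBaseChange_bijective).trans
    (adicBaseChangeCongr A' e)

theorem adicBaseChangeEquiv_apply (e : NullFamily A I ≃ₗ[A] U) (c : NullFamily A' I) :
    adicBaseChangeEquiv A' e c = adicBaseChangeCongr A' e (NullFamily.toAdicBaseChange A A' I c) :=
  rfl

variable {A'}

/-- Congruences in the inverse limit are thereby 𝔪'-adic ones, so continuity may be checked on
components. -/
theorem mem_pow_smul_top_of_apply_eq_zero (e : NullFamily A I ≃ₗ[A] U) {n : ℕ}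
    {y : adicBaseChange A A' U} (hy : y.1 n = 0) :
    y ∈ maximalIdeal A' ^ n • (⊤ : Submodule A' (adicBaseChange A A' U)) := by
  obtain ⟨c, hcy⟩ := (adicBaseChangeEquiv A' e).surjective y
  have h : (adicBaseChangeCongr A' e).symm y = NullFamily.toAdicBaseChange A A' I c := by
    rw [← hcy, adicBaseChangeEquiv_apply, LinearEquiv.symm_apply_apply]
  have hc : c ∈ maximalIdeal A' ^ n • (⊤ : Submodule A' (NullFamily A' I)) := by
    refine NullFamily.mem_pow_smul_top_of_toAdicBaseChange_apply (A := A) ?_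
    rw [← h, adicBaseChangeCongr_symm_apply, hy, map_zero]
  have := map_mem_ideal_smul_top (V := adicBaseChange A A' U)
    (adicBaseChangeEquiv A' e : NullFamily A' I →ₗ[A'] adicBaseChange A A' U) hc
  rwa [LinearEquiv.coe_coe, hcy] at this

theorem contFl_adicBaseChange {G : Type w} [Group G] [TopologicalSpace G] [IsTopologicalGroup G]
    (π : Rep.{u} A G) (hπ : contFl A G π) : contFl A' G ((adicBaseChangeFunctor A' G).obj π) := by
  obtain ⟨I, ⟨e⟩⟩ := IsOrthonormalizable.exists_equiv A π hπ.2
  have hortho : IsOrthonormalizable A' (adicBaseChange A A' π) :=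
    NullFamily.isOrthonormalizable_of_equiv (adicBaseChangeEquiv A' e).symm
  have hπ' := ((isAdicallyContinuous_iff π).1 hπ.1).2
  refine ⟨(isAdicallyContinuous_iff _).2 ⟨hortho.1, fun (y : adicBaseChange A A' π) n => ?_⟩, hortho⟩
  -- A component is a finite sum of pure tensors, each fixed by all g near 1.
  have key : ∀ z : (A' ⧸ maximalIdeal A' ^ n) ⊗[A] π,
      ∀ᶠ g in 𝓝 (1 : G), quotTensorMap le_rfl (π.ρ g) z = z := by
    intro z
    induction z using TensorProduct.induction_on with
    | zero => simp
    | add x y hx hy =>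
      filter_upwards [hx, hy] with g h1 h2
      rw [map_add, h1, h2]
    | tmul b x =>
      filter_upwards [hπ' x n] with g hg
      have h := tmul_eq_zero_of_mem_pow_smul_top A' b hg
      rw [tmul_sub, sub_eq_zero] at h
      obtain ⟨b, rfl⟩ := Ideal.Quotient.mk_surjective b
      exact h
  filter_upwards [key (y.1 n)] with g hg
  exact mem_pow_smul_top_of_apply_eq_zero e (sub_eq_zero.2 hg)

end AdicBaseChange

/-! ### Base change of products -/

section ProBaseChange

section General

variable (A : Type u) [CommRing A] (A' : Type u) [CommRing A'] [TopologicalSpace A'] [Algebra A A']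
  (M : Type v) [AddCommGroup M] [Module A M] [TopologicalSpace M]

variable {M} in
/-- The element `m ⊗ b` of `M ⊗̂ A'`. -/
def proPure (m : M) (b : A') : proBaseChange A A' M :=
  ⟨fun _ => Ideal.Quotient.mk _ b ⊗ₜ Submodule.Quotient.mk m, fun _ _ _ _ => rfl⟩

theorem proBaseChange_hasBasis_nhds (x : proBaseChange A A' M) :
    (𝓝 x).HasBasis (fun _ : OpenPair A A' M => True) fun p => {y | y.1 p = x.1 p} := by
  have h : 𝓝 x = ⨅ p : OpenPair A A' M, Filter.principal {y | y.1 p = x.1 p} := by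
    rw [nhds_iInf]
    refine iInf_congr fun p => ?_
    let : TopologicalSpace ((A' ⧸ p.2.1) ⊗[A] (M ⧸ p.1.1)) := ⊥
    have : DiscreteTopology ((A' ⧸ p.2.1) ⊗[A] (M ⧸ p.1.1)) := ⟨rfl⟩
    rw [nhds_induced, nhds_discrete, Filter.comap_pure]
    rfl
  rw [h]
  have : Nonempty (OpenPair A A' M) := ⟨(⟨⊤, isOpen_univ⟩, ⟨⊤, isOpen_univ⟩)⟩
  refine Filter.hasBasis_iInf_principal fun p q => ?_
  let r : OpenPair A A' M :=
    (⟨p.1.1 ⊓ q.1.1, p.1.2.inter q.1.2⟩, ⟨p.2.1 ⊓ q.2.1, p.2.2.inter q.2.2⟩)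
  refine ⟨r, ?_, ?_⟩
  · intro y hy
    change y.1 p = x.1 p
    rw [← y.2 r p inf_le_left inf_le_left, ← x.2 r p inf_le_left inf_le_left]
    exact congrArg _ hy
  · intro y hy
    change y.1 q = x.1 q
    rw [← y.2 r q inf_le_right inf_le_right, ← x.2 r q inf_le_right inf_le_right]
    exact congrArg _ hy

instance : T2Space (proBaseChange A A' M) := by
  refine ⟨fun x y hxy => ?_⟩
  obtain ⟨p, hp⟩ : ∃ p, x.1 p ≠ y.1 p := by
    by_contra! h
    exact hxy (Subtype.ext (funext h))
  have ho : ∀ z, IsOpen {y : proBaseChange A A' M | y.1 p = z} := fun z =>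
    @IsOpen.preimage _ _ _ ⊥ _ (continuous_proBaseChangeProj A A' M p) {z} trivial
  exact ⟨_, _, ho (x.1 p), ho (y.1 p), rfl, rfl,
    Set.disjoint_left.2 fun z (hz : z.1 p = x.1 p) (hz' : z.1 p = y.1 p) => hp (hz.symm.trans hz')⟩

/-- The elements `m ⊗ b` span a dense submodule of `M ⊗̂ A'`. -/
theorem dense_span_proPure :
    Dense (Submodule.span A' {x : proBaseChange A A' M | ∃ m b, x = proPure A A' m b} :
      Set (proBaseChange A A' M)) := by
  intro x
  rw [mem_closure_iff_nhds_basis (proBaseChange_hasBasis_nhds A A' M x)]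
  intro p _
  have key : ∀ t : (A' ⧸ p.2.1) ⊗[A] (M ⧸ p.1.1),
      ∃ z ∈ Submodule.span A' {x : proBaseChange A A' M | ∃ m b, x = proPure A A' m b},
        z.1 p = t := by
    intro t
    induction t using TensorProduct.induction_on with
    | zero => exact ⟨0, zero_mem _, rfl⟩
    | add s t hs ht =>
      obtain ⟨y, hy, rfl⟩ := hs
      obtain ⟨z, hz, rfl⟩ := ht
      exact ⟨y + z, add_mem hy hz, rfl⟩
    | tmul b m =>
      obtain ⟨b, rfl⟩ := Ideal.Quotient.mk_surjective b
      obtain ⟨m, rfl⟩ := Submodule.Quotient.mk_surjective _ m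
      exact ⟨_, Submodule.subset_span ⟨m, b, rfl⟩, rfl⟩
  obtain ⟨z, hz, hzx⟩ := key (x.1 p)
  exact ⟨z, hz, hzx⟩

variable {A A' M}

theorem proBaseChange_hom_ext {P : Type*} [AddCommGroup P] [Module A' P] [TopologicalSpace P]
    [T2Space P] {f g : proBaseChange A A' M →L[A'] P}
    (h : ∀ m b, f (proPure A A' m b) = g (proPure A A' m b)) : f = g := by
  refine ContinuousLinearMap.ext_on (dense_span_proPure A A' M) ?_
  rintro _ ⟨m, b, rfl⟩
  exact h m b

/-- The completed tensor products of isomorphic topological modules are isomorphic. -/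
def proBaseChangeCongr [TopologicalSpace A] (A' : Type u) [CommRing A'] [TopologicalSpace A']
    [Algebra A A'] {M' : Type v} [AddCommGroup M'] [Module A M'] [TopologicalSpace M']
    (e : M ≃L[A] M') : proBaseChange A A' M ≃L[A'] proBaseChange A A' M' :=
  .equivOfInverse (proBaseChangeMap A' (e : M →L[A] M')) (proBaseChangeMap A' (e.symm : M' →L[A] M))
    (fun x => by
      rw [← ContinuousLinearMap.comp_apply, ← proBaseChangeMap_comp,
        ContinuousLinearEquiv.coe_symm_comp_coe, proBaseChangeMap_id]
      rfl)
    (fun x => by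
      rw [← ContinuousLinearMap.comp_apply, ← proBaseChangeMap_comp,
        ContinuousLinearEquiv.coe_comp_coe_symm, proBaseChangeMap_id]
      rfl)

end General

open Classical in
theorem exists_finset_of_isOpen {A : Type u} [CommRing A] [TopologicalSpace A] {I : Type v}
    {N : Submodule A (I → A)} (hN : IsOpen (N : Set (I → A))) :
    ∃ s : Finset I, ∀ g : I → A, (∀ i ∈ s, g i = 0) → g ∈ N := by
  have h := hN.mem_nhds (zero_mem N)
  rw [nhds_pi, Filter.mem_pi] at h
  obtain ⟨s, hs, t, ht, hst⟩ := h
  refine ⟨hs.toFinset, fun g hg => hst fun i hi => ?_⟩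
  rw [hg i (hs.mem_toFinset.2 hi)]
  exact mem_of_mem_nhds (ht i)

open Classical in
theorem exists_finset_single_mem {A : Type u} [CommRing A] [TopologicalSpace A] {I : Type v}
    {A' : Type u} [CommRing A'] [TopologicalSpace A'] (p : OpenPair A A' (I → A)) :
    ∃ s : Finset I, ∀ i ∉ s, (Pi.single i 1 : I → A) ∈ p.1.1 := by
  obtain ⟨s, hs⟩ := exists_finset_of_isOpen p.1.2
  exact ⟨s, fun i hi => hs _ fun j hj => Pi.single_eq_of_ne (fun h : j = i => hi (h ▸ hj)) _⟩

variable {A : Type u} [CommRing A] [TopologicalSpace A] [IsCompleteNoetherianLocal A]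
  {A' : Type u} [CommRing A'] [TopologicalSpace A'] [IsCompleteNoetherianLocal A']
  [Algebra A A'] {I : Type u}

open Classical in
/-- The component at `p` of the map `A'^I → A^I ⊗̂ A'`. -/
def piToProComponent (p : OpenPair A A' (I → A)) :
    (I → A') →ₗ[A'] (A' ⧸ p.2.1) ⊗[A] ((I → A) ⧸ p.1.1) :=
  ∑ i ∈ (exists_finset_single_mem p).choose,
    (LinearMap.toSpanSingleton A' _
      ((1 : A' ⧸ p.2.1) ⊗ₜ[A] (Submodule.Quotient.mk (Pi.single i 1) : (I → A) ⧸ p.1.1))) ∘ₗ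
      LinearMap.proj i

-- The finite set chosen in `piToProComponent` is immaterial, since further indices contribute zero.
-- Hence the components at different pairs are compatible.
open Classical in
theorem piToProComponent_apply (p : OpenPair A A' (I → A)) {s : Finset I}
    (hs : ∀ i ∉ s, (Pi.single i 1 : I → A) ∈ p.1.1) (c : I → A') :
    piToProComponent p c = ∑ i ∈ s, Ideal.Quotient.mk p.2.1 (c i) ⊗ₜ[A]
      (Submodule.Quotient.mk (Pi.single i 1) : (I → A) ⧸ p.1.1) := by
  have h1 : ∀ i, (Pi.single i 1 : I → A) ∈ p.1.1 →
      Ideal.Quotient.mk p.2.1 (c i) ⊗ₜ[A]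
        (Submodule.Quotient.mk (Pi.single i 1) : (I → A) ⧸ p.1.1) = 0 := fun i hi => by
    rw [(Submodule.Quotient.mk_eq_zero _).2 hi, tmul_zero]
  have h2 : piToProComponent p c = ∑ i ∈ (exists_finset_single_mem p).choose,
      Ideal.Quotient.mk p.2.1 (c i) ⊗ₜ[A]
        (Submodule.Quotient.mk (Pi.single i 1) : (I → A) ⧸ p.1.1) := by
    rw [piToProComponent, LinearMap.sum_apply]
    refine Finset.sum_congr rfl fun i _ => ?_
    change c i • ((1 : A' ⧸ p.2.1) ⊗ₜ[A]
      (Submodule.Quotient.mk (Pi.single i 1) : (I → A) ⧸ p.1.1)) = _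
    rw [TensorProduct.smul_tmul', Algebra.smul_def, mul_one]
    rfl
  rw [h2]
  exact (Finset.sum_subset Finset.subset_union_left fun i _ hi =>
    h1 i ((exists_finset_single_mem p).choose_spec i hi)).trans
    (Finset.sum_subset Finset.subset_union_right fun i _ hi => h1 i (hs i hi)).symm

variable (A') in
variable (A I) in
/-- The map `A'^I → A^I ⊗̂ A'`. -/
def piToPro : (I → A') →L[A'] proBaseChange A A' (I → A) where
  toFun c := ⟨fun p => piToProComponent p c, fun p q h₁ h₂ => by
    classical
    obtain ⟨s, hs⟩ := exists_finset_single_mem p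
    beta_reduce
    rw [piToProComponent_apply p hs, piToProComponent_apply q fun i hi => h₁ (hs i hi), map_sum]
    rfl⟩
  map_add' c d := Subtype.ext <| funext fun p => map_add (piToProComponent p) c d
  map_smul' a c := Subtype.ext <| funext fun p => map_smul (piToProComponent p) a c
  cont := continuous_iInf_rng.2 fun p => continuous_induced_rng.2 <| by
    classical
    let : TopologicalSpace ((A' ⧸ p.2.1) ⊗[A] ((I → A) ⧸ p.1.1)) := ⊥
    have : DiscreteTopology ((A' ⧸ p.2.1) ⊗[A] ((I → A) ⧸ p.1.1)) := ⟨rfl⟩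
    change Continuous (piToProComponent p)
    refine continuous_of_continuousAt_zero (piToProComponent p) ?_
    rw [ContinuousAt, map_zero, nhds_discrete ((A' ⧸ p.2.1) ⊗[A] ((I → A) ⧸ p.1.1)), Filter.tendsto_pure]
    obtain ⟨s, hs⟩ := exists_finset_single_mem p
    have : ∀ᶠ c : I → A' in 𝓝 0, ∀ i ∈ s, c i ∈ p.2.1 := by
      rw [Filter.eventually_all_finset]
      exact fun i _ => (p.2.2.preimage (continuous_apply i)).mem_nhds (zero_mem p.2.1)
    filter_upwards [this] with c hc
    rw [piToProComponent_apply p hs]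
    refine Finset.sum_eq_zero fun i hi => ?_
    rw [Ideal.Quotient.eq_zero_iff_mem.2 (hc i hi), zero_tmul]

theorem piToPro_apply (c : I → A') (p : OpenPair A A' (I → A)) :
    (piToPro A A' I c).1 p = piToProComponent p c := rfl

theorem piToPro_mul_algebraMap (f : I → A) (a : A') :
    piToPro A A' I (fun i => a * algebraMap A A' (f i)) = proPure A A' f a := by
  classical
  refine Subtype.ext (funext fun p => ?_)
  obtain ⟨s, hs⟩ := exists_finset_of_isOpen p.1.2
  have hs' : ∀ i ∉ s, (Pi.single i 1 : I → A) ∈ p.1.1 := fun i hi =>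
    hs _ fun j hj => Pi.single_eq_of_ne (fun h : j = i => hi (h ▸ hj)) _
  rw [piToPro_apply, piToProComponent_apply p hs']
  change _ = Ideal.Quotient.mk p.2.1 a ⊗ₜ (Submodule.Quotient.mk f : (I → A) ⧸ p.1.1)
  have hf : (Submodule.Quotient.mk f : (I → A) ⧸ p.1.1) =
      ∑ i ∈ s, f i • Submodule.Quotient.mk (Pi.single i 1) := by
    have : f - ∑ i ∈ s, f i • (Pi.single i 1 : I → A) ∈ p.1.1 := hs _ fun i hi => by
      simp [Finset.sum_apply, Pi.single_apply, hi]
    rw [(Submodule.Quotient.eq p.1.1).2 this, ← Submodule.mkQ_apply, map_sum]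
    rfl
  rw [hf, tmul_sum]
  refine Finset.sum_congr rfl fun i _ => ?_
  rw [← TensorProduct.smul_tmul, mul_comm, ← Algebra.smul_def]
  rfl

/-- The range is compact, hence closed, and it contains the dense span of the pure tensors. -/
theorem piToPro_surjective : Function.Surjective (piToPro A A' I) := by
  have hc : IsClosed (Set.range (piToPro A A' I)) :=
    (isCompact_range (piToPro A A' I).continuous).isClosed
  have hle : Submodule.span A' {x : proBaseChange A A' (I → A) | ∃ m b, x = proPure A A' m b} ≤
      LinearMap.range (piToPro A A' I).toLinearMap := by
    refine Submodule.span_le.2 ?_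
    rintro _ ⟨f, a, rfl⟩
    exact ⟨_, piToPro_mul_algebraMap f a⟩
  have hd : Dense (Set.range (piToPro A A' I)) := (dense_span_proPure A A' (I → A)).mono hle
  exact Set.range_eq_univ.1 (hc.closure_eq ▸ hd.closure_eq)

variable [IsLocalHom (algebraMap A A')]

/-- The i-th coordinate modulo 𝔪'ⁿ is read off from the component at the pair formed by {g | gᵢ ∈
𝔪ⁿ} and 𝔪'ⁿ, through the form ψ. -/
theorem piToPro_injective : Function.Injective (piToPro A A' I) := by
  classical
  refine (injective_iff_map_eq_zero (piToPro A A' I)).2 fun c hc => funext fun i => ?_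
  refine eq_zero_of_forall_mem_pow fun n => ?_
  let N : Submodule A (I → A) := Submodule.comap (LinearMap.proj i) (maximalIdeal A ^ n)
  let p : OpenPair A A' (I → A) :=
    (⟨N, (isOpen_maximalIdeal_pow n).preimage (continuous_apply i)⟩,
      ⟨maximalIdeal A' ^ n, isOpen_maximalIdeal_pow n⟩)
  let R := A' ⧸ maximalIdeal A' ^ n
  let φ : ((I → A) ⧸ N) →ₗ[A] R :=
    N.liftQ (Algebra.linearMap A R ∘ₗ LinearMap.proj i) fun g hg =>
      Ideal.Quotient.eq_zero_iff_mem.2 (map_maximalIdeal_pow_le (A' := A') hg)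
  let ψ : R ⊗[A] ((I → A) ⧸ N) →ₗ[A] R := LinearMap.mul' A R ∘ₗ TensorProduct.map LinearMap.id φ
  have h : piToProComponent p c = 0 := congrArg (fun x : proBaseChange A A' (I → A) => x.1 p) hc
  rw [piToProComponent_apply p (s := {i}) fun j hj => by
    change (Pi.single j 1 : I → A) i ∈ maximalIdeal A ^ n
    rw [Pi.single_eq_of_ne fun h => hj (by simp [h])]
    exact zero_mem _, Finset.sum_singleton] at h
  have h' : ψ (Ideal.Quotient.mk _ (c i) ⊗ₜ Submodule.Quotient.mk (Pi.single i 1)) =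
      Ideal.Quotient.mk _ (c i) := by
    change Ideal.Quotient.mk _ (c i) * algebraMap A R ((Pi.single i 1 : I → A) i) = _
    rw [Pi.single_eq_same, map_one, mul_one]
  have h'' := congrArg ψ h
  exact Ideal.Quotient.eq_zero_iff_mem.1 (h'.symm.trans (h''.trans (map_zero ψ)))

variable (A') in
variable (A I) in
/-- The isomorphism `A'^I ≅ A^I ⊗̂ A'`. -/
def piProEquiv : (I → A') ≃L[A'] proBaseChange A A' (I → A) :=
  have hf : Function.Bijective (piToPro A A' I) := ⟨piToPro_injective, piToPro_surjective⟩
  ContinuousLinearEquiv.ofBijectiveCompactToT2 (A := A') (M := I → A')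
    (N := proBaseChange A A' (I → A)) (piToPro A A' I) hf

theorem piProEquiv_apply (c : I → A') : piProEquiv A A' I c = piToPro A A' I c := rfl

theorem piProEquiv_symm_proPure (f : I → A) (a : A') :
    (piProEquiv A A' I).symm (proPure A A' f a) = fun i => a * algebraMap A A' (f i) :=
  (piProEquiv A A' I).symm_apply_eq.2 ((piProEquiv_apply _).trans (piToPro_mul_algebraMap f a)).symm

end ProBaseChange

/-! ### Duality commutes with base change -/

section DualBaseChange

/-- The element `x ⊗ b` of `U ⊗̂ A'`. -/
def adicPure {A : Type u} [CommRing A] (A' : Type u) [CommRing A'] [IsLocalRing A'] [Algebra A A']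
    {U : Type v} [AddCommGroup U] [Module A U] (x : U) (b : A') : adicBaseChange A A' U :=
  ⟨fun _ => Ideal.Quotient.mk _ b ⊗ₜ x, fun _ _ _ => rfl⟩

variable {A : Type u} [CommRing A] [TopologicalSpace A] [IsCompleteNoetherianLocal A]
  {A' : Type u} [CommRing A'] [TopologicalSpace A'] [IsCompleteNoetherianLocal A']
  [Algebra A A'] [IsLocalHom (algebraMap A A')]

theorem continuous_algebraMap_of_isLocalHom : Continuous (algebraMap A A') := by
  refine continuous_of_continuousAt_zero (algebraMap A A') ?_
  rw [ContinuousAt, map_zero, hasBasis_nhds_zero.tendsto_iff hasBasis_nhds_zero]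
  exact fun n _ => ⟨n, trivial, fun a ha => map_maximalIdeal_pow_le (A' := A') ha⟩

namespace NullFamily

variable {I : Type u}

/-- The null family `b cᵢ` with values in `A'` obtained from a null family with values in `A`. -/
def mulAlgebraMap (b : A') (c : NullFamily A I) : NullFamily A' I :=
  ⟨fun i => b * algebraMap A A' (c.1 i), fun n => (c.2 n).subset fun _ hi h =>
    hi (Ideal.mul_mem_left _ _ (map_maximalIdeal_pow_le (A' := A') h))⟩

theorem toAdicBaseChange_mulAlgebraMap (b : A') (c : NullFamily A I) :
    toAdicBaseChange A A' I (mulAlgebraMap b c) = adicPure A' c b := by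
  refine Subtype.ext (funext fun n => ?_)
  refine Eq.trans ?_ (tensorCombination_coord n (Ideal.Quotient.mk _ b ⊗ₜ c))
  rw [toAdicBaseChange_apply, tensorCoord, LinearMap.liftBaseChange_tmul]
  refine congrArg _ (Finsupp.ext fun i => ?_)
  exact map_mul (Ideal.Quotient.mk (maximalIdeal A' ^ n)) b _

/-- The map A → A' is continuous, so it may be applied to the convergent sum term by term. -/
theorem pairing_mulAlgebraMap (a b : A') (c : NullFamily A I) (g : I → A) :
    pairing (mulAlgebraMap b c) (fun i => a * algebraMap A A' (g i)) =
      a * b * algebraMap A A' (pairing c g) := by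
  have h := ((summable_mul c g).hasSum.map (algebraMap A A')
    continuous_algebraMap_of_isLocalHom).mul_left (a * b)
  rw [pairing_apply, pairing_apply, ← h.tsum_eq]
  refine tsum_congr fun i => ?_
  simp only [mulAlgebraMap, Function.comp_apply, map_mul]
  ring

end NullFamily

variable {U : Type u} [AddCommGroup U] [Module A U]

theorem adicBaseChangeEquiv_mulAlgebraMap {I : Type u} (e : NullFamily A I ≃ₗ[A] U) (b : A')
    (c : NullFamily A I) :
    adicBaseChangeEquiv A' e (NullFamily.mulAlgebraMap b c) = adicPure A' (e c) b := by
  rw [adicBaseChangeEquiv_apply, NullFamily.toAdicBaseChange_mulAlgebraMap]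
  rfl

/-- A linear form on `U ⊗̂ A'` is determined by its values at the elements `x ⊗ 1`. -/
theorem IsOrthonormalizable.adicBaseChange_dual_ext (hU : IsOrthonormalizable A U)
    {f g : PointwiseDual A' (adicBaseChange A A' U)}
    (h : ∀ x, f (adicPure A' x 1) = g (adicPure A' x 1)) : f = g := by
  obtain ⟨I, ⟨e⟩⟩ := IsOrthonormalizable.exists_equiv A U hU
  let ε : NullFamily A' I ≃ₗ[A'] adicBaseChange A A' U := adicBaseChangeEquiv A' e
  let μ : (I → A') ≃L[A'] PointwiseDual A' (adicBaseChange A A' U) := pointwiseDualPiEquiv ε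
  refine μ.symm.injective ?_
  have key : ∀ (f : PointwiseDual A' (adicBaseChange A A' U)) (i : I),
      μ.symm f i = f (adicPure A' (e (NullFamily.single i 1)) 1) := fun f i => by
    obtain ⟨k, rfl⟩ := μ.surjective f
    rw [ContinuousLinearEquiv.symm_apply_apply, ← adicBaseChangeEquiv_mulAlgebraMap,
      pointwiseDualPiEquiv_apply]
    have : NullFamily.mulAlgebraMap (1 : A') (NullFamily.single i (1 : A)) =
        NullFamily.single i 1 := by
      classical
      refine Subtype.ext (funext fun j => ?_)
      change 1 * algebraMap A A' ((NullFamily.single i (1 : A)).1 j) =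
        (NullFamily.single i (1 : A')).1 j
      rw [NullFamily.coe_single, NullFamily.coe_single, Pi.single_apply, Pi.single_apply]
      split_ifs <;> simp
    rw [this, NullFamily.pairing_single_left, one_mul]
  exact funext fun i => by rw [key, key, h]

variable (A')

/-- The isomorphism is assembled from a choice of coordinates, but the formula on pure tensors is
free of them; only that formula is used afterwards. -/
theorem IsOrthonormalizable.exists_dualBaseChangeEquiv (hU : IsOrthonormalizable A U) :
    ∃ Φ : proBaseChange A A' (PointwiseDual A U) ≃L[A'] PointwiseDual A' (adicBaseChange A A' U),
      ∀ f a x b, Φ (proPure A A' f a) (adicPure A' x b) = a * b * algebraMap A A' (f x) := by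
  obtain ⟨I, ⟨e⟩⟩ := IsOrthonormalizable.exists_equiv A U hU
  refine ⟨((proBaseChangeCongr A' (pointwiseDualPiEquiv e).symm).trans
    (piProEquiv A A' I).symm).trans (pointwiseDualPiEquiv (adicBaseChangeEquiv A' e)),
    fun f a x b => ?_⟩
  obtain ⟨g, rfl⟩ := (pointwiseDualPiEquiv e).surjective f
  obtain ⟨c, rfl⟩ := e.surjective x
  rw [← adicBaseChangeEquiv_mulAlgebraMap, pointwiseDualPiEquiv_apply,
    ← NullFamily.pairing_mulAlgebraMap]
  refine (pointwiseDualPiEquiv_apply _ _ _).trans (congrArg _ ?_)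
  refine Eq.trans (congrArg (piProEquiv A A' I).symm ?_) (piProEquiv_symm_proPure g a)
  change proPure A A' ((pointwiseDualPiEquiv e).symm (pointwiseDualPiEquiv e g)) a = _
  rw [ContinuousLinearEquiv.symm_apply_apply]

/-- The isomorphism `Hom_A(U, A) ⊗̂ A' ≅ Hom_{A'}(U ⊗̂ A', A')`. -/
def IsOrthonormalizable.dualBaseChangeEquiv (hU : IsOrthonormalizable A U) :
    proBaseChange A A' (PointwiseDual A U) ≃L[A'] PointwiseDual A' (adicBaseChange A A' U) :=
  (hU.exists_dualBaseChangeEquiv A').choose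

variable {A'}

theorem IsOrthonormalizable.dualBaseChangeEquiv_proPure (hU : IsOrthonormalizable A U)
    (f : PointwiseDual A U) (a : A') (x : U) (b : A') :
    hU.dualBaseChangeEquiv A' (proPure A A' f a) (adicPure A' x b) =
      a * b * algebraMap A A' (f x) :=
  (hU.exists_dualBaseChangeEquiv A').choose_spec f a x b

/-- Both sides are continuous and linear in y, so it is enough to compare them on f ⊗ a, and there
on the x ⊗ 1. Taking φ to be the action of g⁻¹ yields G-equivariance. -/
theorem IsOrthonormalizable.dualBaseChangeEquiv_naturality {V : Type u} [AddCommGroup V]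
    [Module A V] (hU : IsOrthonormalizable A U) (hV : IsOrthonormalizable A V) (φ : U →ₗ[A] V)
    (y : proBaseChange A A' (PointwiseDual A V)) :
    hU.dualBaseChangeEquiv A' (proBaseChangeMap A' (PointwiseDual.map φ) y) =
      PointwiseDual.map (U := adicBaseChange A A' U) (U' := adicBaseChange A A' V)
        (adicBaseChangeMap A' φ) (hV.dualBaseChangeEquiv A' y) := by
  let φ' : adicBaseChange A A' U →ₗ[A'] adicBaseChange A A' V := adicBaseChangeMap A' φ
  let F : proBaseChange A A' (PointwiseDual A U) →L[A'] PointwiseDual A' (adicBaseChange A A' U) :=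
    hU.dualBaseChangeEquiv A'
  let F' : proBaseChange A A' (PointwiseDual A V) →L[A'] PointwiseDual A' (adicBaseChange A A' V) :=
    hV.dualBaseChangeEquiv A'
  have : F ∘L proBaseChangeMap A' (PointwiseDual.map φ) = PointwiseDual.map φ' ∘L F' :=
    proBaseChange_hom_ext fun f a => hU.adicBaseChange_dual_ext fun x =>
      (hU.dualBaseChangeEquiv_proPure (PointwiseDual.map φ f) a x 1).trans
        (hV.dualBaseChangeEquiv_proPure f a (φ x) 1).symm
  exact DFunLike.congr_fun this y

variable {G : Type w} [Group G] [TopologicalSpace G]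

variable (A') in
variable (A G) in
/-- The natural isomorphism `Hom_A(π, A) ⊗̂ A' ≅ Hom_{A'}(π ⊗̂ A', A')`. -/
def dualBaseChangeNatIso :
    ((contFl.{u} A G).ι.op ⋙ dualFunctor A G ⋙ proBaseChangeFunctor A' G) ≅
      ((contFl.{u} A G).ι.op ⋙ (adicBaseChangeFunctor A' G).op ⋙ dualFunctor A' G) :=
  NatIso.ofComponents
    (fun X => TopRep.isoOfEquiv (X.unop.property.2.dualBaseChangeEquiv A')
      fun g m => X.unop.property.2.dualBaseChangeEquiv_naturality X.unop.property.2
        (X.unop.obj.ρ g⁻¹) m)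
    fun {X Y} f => TopRep.hom_ext <| ContIntertwiningMap.ext <| ContinuousLinearMap.ext fun y =>
      Y.unop.property.2.dualBaseChangeEquiv_naturality X.unop.property.2
        f.unop.hom.hom.toLinearMap y

end DualBaseChange

/-! ### Base change of augmented representations -/

section ProAugBaseChange

/-- Being a topologically free profinite augmented representation is invariant under
isomorphism. -/
theorem proAugFl_of_iso {A : Type u} [CommRing A] [TopologicalSpace A] {G : Type w} [Group G]
    [TopologicalSpace G] {M N : TopRep.{v} A G} (i : M ≅ N) (hM : proAugFl A G M) :
    proAugFl A G N := by
  let e : M ≃L[A] N := .equivOfInverse i.hom.hom.toContinuousLinearMap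
    i.inv.hom.toContinuousLinearMap
    (fun x => by
      have := congrArg (fun f : M ⟶ M => f.hom x) i.hom_inv_id
      exact this)
    (fun x => by
      have := congrArg (fun f : N ⟶ N => f.hom x) i.inv_hom_id
      exact this)
  have he : ∀ g n, e.symm (N.ρ g n) = M.ρ g (e.symm n) := fun g n =>
    TopRep.hom_comm_apply i.inv g n
  obtain ⟨⟨⟨hc, ht, htd, hlin⟩, K, hKo, hKc, hmod, hact, hcont⟩, I, ⟨μ⟩⟩ := hM
  have hlin' : IsLinearTopology A N := by
    refine IsLinearTopology.mk_of_hasBasis' A (ι := Submodule A N) (S := Submodule A N)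
      (p := fun P => IsOpen (P : Set N)) (s := id) ⟨fun s => ⟨fun hs => ?_, ?_⟩⟩
      fun P a m hm => P.smul_mem a hm
    · have hs' : e ⁻¹' s ∈ 𝓝 (0 : M) := e.continuous.continuousAt.preimage_mem_nhds (by
        rwa [map_zero])
      obtain ⟨P, hP, hPs⟩ := (IsLinearTopology.hasBasis_open_submodule A).mem_iff.1 hs'
      refine ⟨P.comap (e.symm : N →ₗ[A] M), hP.preimage e.symm.continuous, fun n hn => ?_⟩
      have : e (e.symm n) ∈ s := hPs hn
      rwa [ContinuousLinearEquiv.apply_symm_apply] at this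
    · rintro ⟨P, hP, hPs⟩
      exact Filter.mem_of_superset (hP.mem_nhds (zero_mem P)) hPs
  -- The A[[K]]-module structure is transported along e.
  let smulN : SMul (CompletedGroupAlgebra A K) N := ⟨fun r n => e (r • e.symm n)⟩
  have hsmul : ∀ (r : CompletedGroupAlgebra A K) (n : N), r • n = e (r • e.symm n) :=
    fun _ _ => rfl
  let modN : Module (CompletedGroupAlgebra A K) N :=
    e.symm.injective.module (CompletedGroupAlgebra A K) (e.symm : N ≃+ M).toAddMonoidHom
      fun r n => e.symm_apply_apply _
  refine ⟨⟨⟨e.toHomeomorph.compactSpace, e.toHomeomorph.t2Space,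
    e.toHomeomorph.totallyDisconnectedSpace, hlin'⟩, K, hKo, hKc, modN, fun x n => ?_, ?_⟩,
    I, ⟨e.symm.trans μ⟩⟩
  · refine (congrArg e (hact x (e.symm n))).trans (e.symm_apply_eq.1 ?_).symm
    induction x using MonoidAlgebra.induction_linear with
    | zero => simp
    | add x y hx hy => simp [hx, hy]
    | single k a =>
      simp only [Representation.asAlgebraHom_single, LinearMap.smul_apply]
      exact (map_smul e.symm a _).trans (congrArg (a • ·) (he k n))
  · exact e.continuous.comp (hcont.comp (continuous_fst.prodMk (e.symm.continuous.comp continuous_snd)))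

variable {A : Type u} [CommRing A] [TopologicalSpace A] [IsCompleteNoetherianLocal A]
  {A' : Type u} [CommRing A'] [TopologicalSpace A'] [IsCompleteNoetherianLocal A']
  [Algebra A A'] [IsLocalHom (algebraMap A A')]
  {G : Type w} [Group G] [TopologicalSpace G] [IsTopologicalGroup G] [T2Space G]
  [LocallyCompactSpace G] [TotallyDisconnectedSpace G]

/-- No A'[[K]]-action is built by hand. By biduality M is the dual of M^∨, so M ⊗̂ A' is the dual of
M^∨ ⊗̂ A', to which `proAugFl_dual` applies. -/
theorem proAugFl_proBaseChange (M : TopRep.{u} A G) (hM : proAugFl A G M) :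
    proAugFl A' G ((proBaseChangeFunctor A' G).obj M) := by
  have hE := contFl_contDual M hM
  have := isIso_evalTopRep M hM
  exact proAugFl_of_iso
    (((proBaseChangeFunctor A' G).mapIso (asIso (evalTopRep A G M))) ≪≫
      (dualBaseChangeNatIso A A' G).app (.op ⟨_, hE⟩)).symm
    (proAugFl_dual _ (contFl_adicBaseChange (A' := A') _ hE))

end ProAugBaseChange

end

/-- Duality between orthonormalizable `𝔪`-adically continuous `A[G]`-modules and topologically free
profinite augmented `G`-representations over `A`, and its compatibility with base change. The
functors `π ↦ Hom_A(π, A)` and `M ↦ Hom_A^cont(M, A)` restrict to the two categories, both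
restrictions are equivalences, and they are mutually quasi-inverse through the evaluation maps.
Base change along a local homomorphism `A → A'` preserves both categories, and there is a natural
isomorphism `Hom_A(π, A) ⊗̂_A A' ≅ Hom_{A'}(π ⊗̂_A A', A')` of topological representations, which
sends `f ⊗ a` to the linear form with `x ⊗ b ↦ a b f(x)`. -/
theorem mainTheorem9
    (G : Type w) [Group G] [TopologicalSpace G] [IsTopologicalGroup G] [T2Space G]
    [LocallyCompactSpace G] [TotallyDisconnectedSpace G]
    (A : Type u) [CommRing A] [TopologicalSpace A] [IsCompleteNoetherianLocal A] :
    (∃ (hD : ∀ π : Rep.{u} A G, contFl A G π → proAugFl A G ((dualFunctor A G).obj (.op π)))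
      (hE : ∀ M : TopRep.{u} A G, proAugFl A G M →
        contFl A G ((contDualFunctor A G).obj (.op M))),
      (dualFl A G hD).IsEquivalence ∧ (contDualFl A G hE).IsEquivalence ∧
      (∀ π : Rep.{u} A G, contFl A G π → IsIso (evalRep A G π)) ∧
      (∀ M : TopRep.{u} A G, proAugFl A G M → IsIso (evalTopRep A G M))) ∧
    (∀ (A' : Type u) [CommRing A'] [TopologicalSpace A'] [IsCompleteNoetherianLocal A']
      [Algebra A A'] [IsLocalHom (algebraMap A A')],
      (∀ π : Rep.{u} A G, contFl A G π → contFl A' G ((adicBaseChangeFunctor A' G).obj π)) ∧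
      (∀ M : TopRep.{u} A G, proAugFl A G M → proAugFl A' G ((proBaseChangeFunctor A' G).obj M)) ∧
      ∃ Φ : ((contFl.{u} A G).ι.op ⋙ dualFunctor A G ⋙ proBaseChangeFunctor A' G) ≅
          ((contFl.{u} A G).ι.op ⋙ (adicBaseChangeFunctor A' G).op ⋙ dualFunctor A' G),
        ∀ (X : (contFl.{u} A G).FullSubcategory) (f : (dualFunctor A G).obj (.op X.obj))
          (a b : A') (x : X.obj),
          dualApply ((adicBaseChangeFunctor A' G).obj X.obj)
            ((Φ.hom.app (.op X)).hom (proTmul A' ((dualFunctor A G).obj (.op X.obj)) f a))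
            (adicTmul A' X.obj x b) = a * b * algebraMap A A' (dualApply X.obj f x)) := by
  refine ⟨⟨proAugFl_dual, contFl_contDual, isEquivalence_dualFl proAugFl_dual contFl_contDual,
    isEquivalence_contDualFl contFl_contDual proAugFl_dual,
    isIso_evalRep, isIso_evalTopRep⟩, fun A' _ _ _ _ _ => ⟨contFl_adicBaseChange,
    proAugFl_proBaseChange, dualBaseChangeNatIso A A' G, fun X f a b x => ?_⟩⟩
  exact X.property.2.dualBaseChangeEquiv_proPure f a x b
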